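/- Let $\mathbb D$ be the open unit disc. The Hardy space $H^2(\mathbb D)$ consists of the holomorphic functions $f$ on $\mathbb D$ with $$\|f\|_{H^2}^2=\sup_{0<r<1}\frac1{2\pi}\int_0^{2\pi}|f(re^{i\theta})|^2\,d\theta<\infty,$$ and, for $\alpha>-1$, the weighted Bergman space $A^2_\alpha(\mathbb D)$ consists of the holomorphic functions $f$ on $\mathbb D$ with $$\|f\|_{A^2_\alpha}^2=\frac{\alpha+1}{\pi}\int_{\mathbb D}|f(z)|^2(1-|z|^2)^\alpha\,dA(z)<\infty,$$ where $dA$ is area measure. Let $\varphi$ be a hyperbolic automorphism of $\mathbb D$, that is, a holomorphic bijection of $\mathbb D$ onto itself with no fixed point in $\mathbb D$ whose continuous extension to $\overline{\mathbb D}$ has two distinct fixed points on the unit circle. Let $a$ be its Denjoy–Wolff point (the point of the unit circle to which the iterates of $\varphi$ converge uniformly on compact subsets of $\mathbb D$) and let $b\neq a$ be its other fixed point. Let $\psi$ be continuous on $\overline{\mathbb D}$, holomorphic on $\mathbb D$, and bounded away from zero, i.e. $\inf_{z\in\mathbb D}|\psi(z)|>0$. Then $\varphi$ extends holomorphically to neighbourhoods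 of $a$ and of $b$, the derivatives $\varphi'(a)$ and $\varphi'(b)$ are real, and $\rho:=\varphi'(b)=\varphi'(a)^{-1}>1$. The weighted composition operator $C_{\psi,\varphi}f=\psi\cdot(f\circ\varphi)$ is bounded on $H^2(\mathbb D)$ and on $A^2_\alpha(\mathbb D)$ for every $\alpha>-1$. Its spectrum on $H^2(\mathbb D)$ is $$\left\{\lambda\in\mathbb C:\ \min\{|\psi(a)|\rho^{1/2},|\psi(b)|\rho^{-1/2}\}\le|\lambda|\le\max\{|\psi(a)|\rho^{1/2},|\psi(b)|\rho^{-1/2}\}\right\},$$ and its spectrum on $A^2_\alpha(\mathbb D)$ is $$\left\{\lambda\in\mathbb C:\ \min\{|\psi(a)|\rho^{(\alpha+2)/2},|\psi(b)|\rho^{-(\alpha+2)/2}\}\le|\lambda|\le\max\{|\psi(a)|\rho^{(\alpha+2)/2},|\psi(b)|\rho^{-(\alpha+2)/2}\}\right\}.$$ -/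

import Mathlib

open MeasureTheory Filter Topology Metric
open scoped ENNReal

noncomputable section

namespace WeightedComp

/-- The open unit disc of the complex plane. -/
abbrev disc : Set ℂ := ball (0 : ℂ) 1

/-! ### Automorphisms of the disc -/

/-- A holomorphic automorphism of the disc: a holomorphic bijection of the disc onto itself.
The values of `φ` outside the disc play no role. -/
def IsDiscAut (φ : ℂ → ℂ) : Prop :=
  DifferentiableOn ℂ φ disc ∧ Set.BijOn φ disc disc

/-- `ζ` is a point of the unit circle that is fixed by the continuous extension of `φ`. -/
def IsBoundaryFixedPt (φ : ℂ → ℂ) (ζ : ℂ) : Prop :=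
  ζ ∈ sphere (0 : ℂ) 1 ∧ Tendsto φ (𝓝[disc] ζ) (𝓝 ζ)

/-- A hyperbolic automorphism: no fixed point in the disc and two distinct fixed points on the
unit circle. -/
def IsHyperbolicAut (φ : ℂ → ℂ) : Prop :=
  IsDiscAut φ ∧ (∀ z ∈ disc, φ z ≠ z) ∧
    ∃ ζ ξ : ℂ, ζ ≠ ξ ∧ IsBoundaryFixedPt φ ζ ∧ IsBoundaryFixedPt φ ξ

/-- `a` is the Denjoy-Wolff point of (the fixed point free automorphism) `φ`: the iterates of `φ`
converge to the boundary point `a`, uniformly on compact subsets of the disc. -/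
def IsDenjoyWolffPt (φ : ℂ → ℂ) (a : ℂ) : Prop :=
  a ∈ sphere (0 : ℂ) 1 ∧
    TendstoLocallyUniformlyOn (fun n : ℕ => φ^[n]) (fun _ => a) atTop disc

/-- `φ'(ζ) = c` at a boundary point `ζ`: near `ζ`, the map `φ` extends from the disc to a function
holomorphic in a neighbourhood of `ζ`, whose derivative at `ζ` is `c`. -/
def HasBoundaryDeriv (φ : ℂ → ℂ) (c ζ : ℂ) : Prop :=
  ∃ Φ : ℂ → ℂ, AnalyticAt ℂ Φ ζ ∧ (∀ᶠ z in 𝓝[disc] ζ, Φ z = φ z) ∧ HasDerivAt Φ c ζ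

/-- `ψ` is bounded away from zero on the disc. -/
def BoundedAwayFromZero (ψ : ℂ → ℂ) : Prop :=
  ∃ c : ℝ, 0 < c ∧ ∀ z ∈ disc, c ≤ ‖ψ z‖

/-! ### Holomorphic functions on the disc

A function on the disc is represented by its extension by zero to the whole plane, so that two
such functions are equal as soon as they agree on the disc. -/

/-- The space of all holomorphic functions on the disc. -/
def holo : Submodule ℂ (ℂ → ℂ) where
  carrier := {f | DifferentiableOn ℂ f disc ∧ ∀ z ∉ disc, f z = 0}
  zero_mem' := ⟨differentiableOn_const 0, fun _ _ => rfl⟩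
  add_mem' hf hg := ⟨hf.1.add hg.1, fun z hz => by simp [hf.2 z hz, hg.2 z hz]⟩
  smul_mem' c _ hf := ⟨hf.1.const_smul c, fun z hz => by simp [hf.2 z hz]⟩

/-! ### The Hardy space -/

/-- The normalized arc length measure on the unit circle, in the angular coordinate. -/
def arcMeasure : Measure ℝ :=
  ENNReal.ofReal (2 * Real.pi)⁻¹ • volume.restrict (Set.Ioc 0 (2 * Real.pi))

/-- The `L²` norm of `θ ↦ f (r e^{iθ})` with respect to normalized arc length. -/
def circleNorm (r : ℝ) (f : ℂ → ℂ) : ℝ≥0∞ :=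
  eLpNorm (fun θ : ℝ => f (circleMap 0 r θ)) 2 arcMeasure

/-- The (possibly infinite) Hardy norm: the supremum over `0 < r < 1` of the `L²` norms of `f` on
the circles of radius `r`. -/
def hardyENorm (f : ℂ → ℂ) : ℝ≥0∞ :=
  ⨆ r : Set.Ioo (0 : ℝ) 1, circleNorm r f

lemma circleMap_mem_disc {r : ℝ} (hr : r ∈ Set.Ioo (0 : ℝ) 1) (θ : ℝ) :
    circleMap 0 r θ ∈ disc := by
  simp [abs_of_pos hr.1, hr.2]

lemma continuous_circle {f : ℂ → ℂ} (hf : f ∈ holo) {r : ℝ} (hr : r ∈ Set.Ioo (0 : ℝ) 1) :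
    Continuous fun θ : ℝ => f (circleMap 0 r θ) :=
  hf.1.continuousOn.comp_continuous (continuous_circleMap 0 r) (circleMap_mem_disc hr)

lemma hardyENorm_add_le {f g : ℂ → ℂ} (hf : f ∈ holo) (hg : g ∈ holo) :
    hardyENorm (f + g) ≤ hardyENorm f + hardyENorm g := by
  refine iSup_le fun r => ?_
  refine le_trans ?_ (add_le_add (le_iSup (fun r : Set.Ioo (0 : ℝ) 1 => circleNorm r f) r)
    (le_iSup (fun r : Set.Ioo (0 : ℝ) 1 => circleNorm r g) r))
  exact eLpNorm_add_le (continuous_circle hf r.2).aestronglyMeasurable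
    (continuous_circle hg r.2).aestronglyMeasurable (by norm_num)

lemma hardyENorm_smul (c : ℂ) (f : ℂ → ℂ) : hardyENorm (c • f) = ‖c‖ₑ * hardyENorm f := by
  unfold hardyENorm
  rw [ENNReal.mul_iSup]
  exact iSup_congr fun r => eLpNorm_const_smul c _ 2 _

lemma hardyENorm_zero : hardyENorm 0 = 0 := by
  simpa using hardyENorm_smul 0 0

lemma eq_zero_of_hardyENorm {f : ℂ → ℂ} (hf : f ∈ holo) (h : hardyENorm f = 0) : f = 0 := by
  have hpos : (0 : ℝ) < 2 * Real.pi := by positivity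
  have key : ∀ r ∈ Set.Ioo (0 : ℝ) 1, ∀ θ ∈ Set.Ioo 0 (2 * Real.pi), f (circleMap 0 r θ) = 0 := by
    intro r hr
    have h0 : circleNorm r f = 0 := by
      have := (ENNReal.iSup_eq_zero.1 h) ⟨r, hr⟩
      exact this
    have hc := continuous_circle hf hr
    rw [circleNorm, eLpNorm_eq_zero_iff hc.aestronglyMeasurable (by norm_num), arcMeasure] at h0
    rw [Measure.ae_ennreal_smul_measure_eq (by simpa using hpos)] at h0
    have h1 : (fun θ : ℝ => f (circleMap 0 r θ)) =ᵐ[volume.restrict (Set.Ioo 0 (2 * Real.pi))]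
        (fun _ => (0 : ℂ)) := ae_restrict_of_ae_restrict_of_subset Set.Ioo_subset_Ioc_self h0
    exact Measure.eqOn_open_of_ae_eq h1 isOpen_Ioo hc.continuousOn continuousOn_const
  have hcl : ∀ r ∈ Set.Ioo (0 : ℝ) 1, ∀ θ : ℝ, f (circleMap 0 r θ) = 0 := by
    intro r hr
    have hc := continuous_circle hf hr
    have h2 : Set.EqOn (fun θ : ℝ => f (circleMap 0 r θ)) (fun _ => (0 : ℂ))
        (Set.Icc 0 (2 * Real.pi)) := by
      have := Set.EqOn.closure (key r hr) hc continuous_const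
      rwa [closure_Ioo hpos.ne] at this
    intro θ
    obtain ⟨θ', hθ', he⟩ := (periodic_circleMap 0 r).exists_mem_Ico₀ hpos θ
    rw [he]
    exact h2 (Set.Ico_subset_Icc_self hθ')
  have hne : Set.EqOn f (fun _ => 0) (disc \ {0}) := by
    rintro z ⟨hz, hz0⟩
    have hz' : ‖z‖ < 1 := by simpa using hz
    have := hcl ‖z‖ ⟨norm_pos_iff.2 hz0, hz'⟩ (Complex.arg z)
    rwa [circleMap_zero, Complex.norm_mul_exp_arg_mul_I] at this
  funext z
  by_cases hz : z ∈ disc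
  · have hsub : disc ⊆ closure (disc \ {0}) := by
      have := (dense_compl_singleton (0 : ℂ)).open_subset_closure_inter (isOpen_ball (x := (0 : ℂ)) (ε := 1))
      simpa [Set.sdiff_eq] using this
    exact hne.of_subset_closure hf.1.continuousOn continuousOn_const Set.sdiff_subset hsub hz
  · exact hf.2 z hz

/-- The functions of the Hardy space `H²` of the disc. -/
def hardySubmodule : Submodule ℂ (ℂ → ℂ) where
  carrier := {f | f ∈ holo ∧ hardyENorm f < ∞}
  zero_mem' := ⟨holo.zero_mem, by simp [hardyENorm_zero]⟩
  add_mem' hf hg := ⟨holo.add_mem hf.1 hg.1,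
    (hardyENorm_add_le hf.1 hg.1).trans_lt (ENNReal.add_lt_top.2 ⟨hf.2, hg.2⟩)⟩
  smul_mem' c f hf := ⟨holo.smul_mem c hf.1, by
    rw [hardyENorm_smul]; exact ENNReal.mul_lt_top enorm_lt_top hf.2⟩

/-- The Hardy space `H²` of the disc, as a normed space with the norm `hardyENorm`. -/
def HardySpace : Type := hardySubmodule

namespace HardySpace

instance : AddCommGroup HardySpace := inferInstanceAs (AddCommGroup hardySubmodule)

instance : Module ℂ HardySpace := inferInstanceAs (Module ℂ hardySubmodule)

instance : CoeFun HardySpace fun _ => ℂ → ℂ := ⟨fun f => f.1⟩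

instance : NormedAddCommGroup HardySpace :=
  AddGroupNorm.toNormedAddCommGroup
    { toFun := fun f => (hardyENorm f).toReal
      map_zero' := by
        change (hardyENorm 0).toReal = 0
        simp [hardyENorm_zero]
      add_le' := fun f g => by
        rw [← ENNReal.toReal_add f.2.2.ne g.2.2.ne]
        exact ENNReal.toReal_mono (ENNReal.add_ne_top.2 ⟨f.2.2.ne, g.2.2.ne⟩)
          (hardyENorm_add_le f.2.1 g.2.1)
      neg' := fun f => by
        have : hardyENorm (-f.1) = hardyENorm f.1 := by
          simpa using hardyENorm_smul (-1) f.1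
        exact congrArg ENNReal.toReal this
      eq_zero_of_map_eq_zero' := fun f hf => by
        have h0 : hardyENorm f.1 = 0 :=
          (ENNReal.toReal_eq_zero_iff _).1 hf |>.resolve_right f.2.2.ne
        exact Subtype.ext (eq_zero_of_hardyENorm f.2.1 h0) }

lemma norm_def (f : HardySpace) : ‖f‖ = (hardyENorm f).toReal := rfl

instance : NormedSpace ℂ HardySpace where
  norm_smul_le c f := by
    change (hardyENorm (c • f.1)).toReal ≤ ‖c‖ * (hardyENorm f.1).toReal
    rw [hardyENorm_smul, ENNReal.toReal_mul, toReal_enorm]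

end HardySpace

/-! ### The weighted Bergman spaces -/

/-- The measure `((α + 1) / π) (1 - |z|²)^α dA(z)` on the disc, a probability measure for
`α > -1`. -/
def bergmanMeasure (α : ℝ) : Measure ℂ :=
  (volume.restrict disc).withDensity
    fun z => ENNReal.ofReal ((α + 1) / Real.pi * (1 - ‖z‖ ^ 2) ^ α)

/-- The (possibly infinite) norm of the weighted Bergman space. -/
def bergmanENorm (α : ℝ) (f : ℂ → ℂ) : ℝ≥0∞ :=
  eLpNorm f 2 (bergmanMeasure α)

lemma holo_aestronglyMeasurable {f : ℂ → ℂ} (hf : f ∈ holo) (α : ℝ) :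
    AEStronglyMeasurable f (bergmanMeasure α) :=
  (hf.1.continuousOn.aestronglyMeasurable measurableSet_ball).mono_ac
    (withDensity_absolutelyContinuous _ _)

lemma bergmanENorm_add_le (α : ℝ) {f g : ℂ → ℂ} (hf : f ∈ holo) (hg : g ∈ holo) :
    bergmanENorm α (f + g) ≤ bergmanENorm α f + bergmanENorm α g :=
  eLpNorm_add_le (holo_aestronglyMeasurable hf α) (holo_aestronglyMeasurable hg α) (by norm_num)

lemma bergmanENorm_smul (α : ℝ) (c : ℂ) (f : ℂ → ℂ) :
    bergmanENorm α (c • f) = ‖c‖ₑ * bergmanENorm α f :=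
  eLpNorm_const_smul c f 2 _

lemma bergmanENorm_zero (α : ℝ) : bergmanENorm α 0 = 0 := by
  simpa using bergmanENorm_smul α 0 0

lemma eq_zero_of_bergmanENorm {α : ℝ} (hα : -1 < α) {f : ℂ → ℂ} (hf : f ∈ holo)
    (h : bergmanENorm α f = 0) : f = 0 := by
  rw [bergmanENorm, eLpNorm_eq_zero_iff (holo_aestronglyMeasurable hf α) (by norm_num),
    bergmanMeasure, EventuallyEq, ae_withDensity_iff (by fun_prop)] at h
  have h1 : f =ᵐ[volume.restrict disc] fun _ => (0 : ℂ) := by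
    filter_upwards [h, ae_restrict_mem measurableSet_ball] with z hz hzd
    have hz1 : ‖z‖ < 1 := by simpa using hzd
    have hz2 : 0 < 1 - ‖z‖ ^ 2 := by nlinarith [norm_nonneg z]
    have hα' : 0 < α + 1 := by linarith
    refine hz (ne_of_gt (ENNReal.ofReal_pos.2 ?_))
    have := Real.rpow_pos_of_pos hz2 α
    positivity
  have h2 := Measure.eqOn_open_of_ae_eq h1 isOpen_ball hf.1.continuousOn continuousOn_const
  funext z
  by_cases hz : z ∈ disc
  · exact h2 hz
  · exact hf.2 z hz

/-- The functions of the weighted Bergman space `A²_α` of the disc. -/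
def bergmanSubmodule (α : ℝ) : Submodule ℂ (ℂ → ℂ) where
  carrier := {f | f ∈ holo ∧ bergmanENorm α f < ∞}
  zero_mem' := ⟨holo.zero_mem, by simp [bergmanENorm_zero]⟩
  add_mem' hf hg := ⟨holo.add_mem hf.1 hg.1,
    (bergmanENorm_add_le α hf.1 hg.1).trans_lt (ENNReal.add_lt_top.2 ⟨hf.2, hg.2⟩)⟩
  smul_mem' c f hf := ⟨holo.smul_mem c hf.1, by
    rw [bergmanENorm_smul]; exact ENNReal.mul_lt_top enorm_lt_top hf.2⟩

/-- The weighted Bergman space `A²_α` of the disc, `α > -1`, as a normed space with the norm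
`bergmanENorm α`. -/
def BergmanSpace (α : ℝ) (_hα : -1 < α) : Type := bergmanSubmodule α

namespace BergmanSpace

variable {α : ℝ} {hα : -1 < α}

instance : AddCommGroup (BergmanSpace α hα) := inferInstanceAs (AddCommGroup (bergmanSubmodule α))

instance : Module ℂ (BergmanSpace α hα) := inferInstanceAs (Module ℂ (bergmanSubmodule α))

instance : CoeFun (BergmanSpace α hα) fun _ => ℂ → ℂ := ⟨fun f => f.1⟩

instance : NormedAddCommGroup (BergmanSpace α hα) :=
  AddGroupNorm.toNormedAddCommGroup
    { toFun := fun f => (bergmanENorm α f).toReal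
      map_zero' := by
        change (bergmanENorm α 0).toReal = 0
        simp [bergmanENorm_zero]
      add_le' := fun f g => by
        rw [← ENNReal.toReal_add f.2.2.ne g.2.2.ne]
        exact ENNReal.toReal_mono (ENNReal.add_ne_top.2 ⟨f.2.2.ne, g.2.2.ne⟩)
          (bergmanENorm_add_le α f.2.1 g.2.1)
      neg' := fun f => by
        have : bergmanENorm α (-f.1) = bergmanENorm α f.1 := by
          simpa using bergmanENorm_smul α (-1) f.1
        exact congrArg ENNReal.toReal this
      eq_zero_of_map_eq_zero' := fun f hf => by
        have h0 : bergmanENorm α f.1 = 0 :=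
          (ENNReal.toReal_eq_zero_iff _).1 hf |>.resolve_right f.2.2.ne
        exact Subtype.ext (eq_zero_of_bergmanENorm hα f.2.1 h0) }

lemma norm_def (f : BergmanSpace α hα) : ‖f‖ = (bergmanENorm α f).toReal := rfl

instance : NormedSpace ℂ (BergmanSpace α hα) where
  norm_smul_le c f := by
    change (bergmanENorm α (c • f.1)).toReal ≤ ‖c‖ * (bergmanENorm α f.1).toReal
    rw [bergmanENorm_smul, ENNReal.toReal_mul, toReal_enorm]

end BergmanSpace

/-! ### Annuli -/

/-- The closed annulus centred at `0` whose two radii are `s` and `t`, in either order. -/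
def annulus (s t : ℝ) : Set ℂ := {z | min s t ≤ ‖z‖ ∧ ‖z‖ ≤ max s t}

end WeightedComp

end

noncomputable section

namespace WeightedComp

open scoped ComplexConjugate

/-! In the coordinate w = `halfPlaneCoord a b` the automorphism is w ↦ ρw with ρ > 1, so its orbits
run from b to a. Both kinds of spaces are handled through `DiscSpace E γ`, with γ = 1/2 for H² and γ
= (α+2)/2 for A²_α; the main property used is that a weighted composition operator has norm at most
sup |ψ||φ'|^{-γ}. The function |ψ||φ'|^{-γ} (`growth`) tends to Ra = |ψ(a)|ρ^γ at a and to Rb =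
|ψ(b)|ρ^{-γ} at b, and these are the two radii.

The spectrum lies in the annulus: ‖Tⁿ‖ is bounded by a product of `growth` along n steps of an
orbit. All but a bounded number of these steps are near a or b, so the product is O(Rⁿ) for every R
> max(Ra, Rb) (`IsHypMob.prod_le`). The inverse of T has the same form with a and b exchanged and
radii Rb⁻¹ and Ra⁻¹, which gives the lower bound.

The annulus is filled: take a bounded holomorphic h with h(0) ≠ 0 that vanishes on the rest of the
orbit of 0 (`exists_orbit_interpolation`). If Ra < |λ| < Rb, the functional f ↦ ∑ λ^{-n} (Tⁿf)(0), n
∈ ℤ, converges for every f, kills the range of λ - T and is nonzero at h. If Rb < |λ| < Ra and h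
also vanishes to high order at a and b, then ∑ λ^{-n} Tⁿh converges to an eigenvector. Closedness of
the spectrum adds the boundary circles. If Ra = Rb, the spectrum is nonempty and invariant under
rotation, because multiplication by w^{is} conjugates T to a unimodular multiple of itself.

The norm estimate is a change of variables for A²_α. For H² it follows by letting α → -1, since
integral means increase with the radius. -/

/-- The Möbius transformation `z ↦ u (z - p) / (1 - p̄ z)`, an automorphism of the disc when
`‖u‖ = 1` and `‖p‖ < 1`. -/
def mob (u p z : ℂ) : ℂ := u * (z - p) / (1 - conj p * z)

/-! ### Möbius maps of the disc -/

lemma mem_disc {z : ℂ} : z ∈ disc ↔ ‖z‖ < 1 := by simp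

lemma one_sub_norm_sq_pos {z : ℂ} (hz : z ∈ disc) : 0 < 1 - ‖z‖ ^ 2 := by
  have := mem_disc.1 hz
  nlinarith [norm_nonneg z]

lemma mob_den_ne {p z : ℂ} (hp : ‖p‖ < 1) (hz : ‖z‖ ≤ 1) : 1 - conj p * z ≠ 0 := by
  intro h
  have h1 : conj p * z = 1 := (sub_eq_zero.1 h).symm
  have h2 : ‖p‖ * ‖z‖ = 1 := by simpa using congrArg norm h1
  nlinarith [norm_nonneg p, norm_nonneg z]

lemma norm_one_sub_conj_mul_sq (p z : ℂ) :
    ‖1 - conj p * z‖ ^ 2 - ‖z - p‖ ^ 2 = (1 - ‖p‖ ^ 2) * (1 - ‖z‖ ^ 2) := by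
  simp only [← Complex.normSq_eq_norm_sq, Complex.normSq_apply]
  simp
  ring

lemma one_sub_norm_mob_sq {u p z : ℂ} (hu : ‖u‖ = 1) (hp : ‖p‖ < 1) (hz : ‖z‖ ≤ 1) :
    1 - ‖mob u p z‖ ^ 2 = (1 - ‖p‖ ^ 2) / ‖1 - conj p * z‖ ^ 2 * (1 - ‖z‖ ^ 2) := by
  have h : ‖1 - conj p * z‖ ≠ 0 := norm_ne_zero_iff.2 (mob_den_ne hp hz)
  rw [mob, norm_div, norm_mul, hu, one_mul, div_pow, div_mul_eq_mul_div,
    ← norm_one_sub_conj_mul_sq, sub_div, div_self (pow_ne_zero 2 h)]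

lemma norm_mob_le {u p z : ℂ} (hu : ‖u‖ = 1) (hp : ‖p‖ < 1) (hz : ‖z‖ ≤ 1) :
    ‖mob u p z‖ ≤ 1 := by
  have h := one_sub_norm_mob_sq hu hp hz
  have h1 : 0 ≤ 1 - ‖p‖ ^ 2 := by nlinarith [norm_nonneg p]
  have h2 : 0 ≤ 1 - ‖z‖ ^ 2 := by nlinarith [norm_nonneg z]
  have : 0 ≤ 1 - ‖mob u p z‖ ^ 2 := by rw [h]; positivity
  nlinarith [norm_nonneg (mob u p z)]

lemma mob_mem_disc {u p z : ℂ} (hu : ‖u‖ = 1) (hp : ‖p‖ < 1) (hz : z ∈ disc) :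
    mob u p z ∈ disc := by
  have h := one_sub_norm_mob_sq hu hp (mem_disc.1 hz).le
  have h1 : 0 < 1 - ‖p‖ ^ 2 := by nlinarith [norm_nonneg p]
  have h2 := one_sub_norm_sq_pos hz
  have h3 : 0 < ‖1 - conj p * z‖ := norm_pos_iff.2 (mob_den_ne hp (mem_disc.1 hz).le)
  have : 0 < 1 - ‖mob u p z‖ ^ 2 := by rw [h]; positivity
  rw [mem_disc]
  nlinarith [norm_nonneg (mob u p z)]

lemma conj_mul_self_of_norm_eq_one {u : ℂ} (hu : ‖u‖ = 1) : conj u * u = 1 := by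
  rw [mul_comm, Complex.mul_conj, Complex.normSq_eq_norm_sq, hu]; simp

lemma norm_neg_mul_lt {u p : ℂ} (hu : ‖u‖ = 1) (hp : ‖p‖ < 1) : ‖-(u * p)‖ < 1 := by
  simpa [hu] using hp

lemma mob_mob_inv {u p z : ℂ} (hu : ‖u‖ = 1) (hp : ‖p‖ < 1) (hz : ‖z‖ ≤ 1) :
    mob (conj u) (-(u * p)) (mob u p z) = z := by
  have h0 := mob_den_ne hp hz
  have h1 := mob_den_ne (norm_neg_mul_lt hu hp) (norm_mob_le hu hp hz)
  have huu := conj_mul_self_of_norm_eq_one hu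
  rw [mob, div_eq_iff h1]
  have h2 : mob u p z * (1 - conj p * z) = u * (z - p) := div_mul_cancel₀ _ h0
  refine mul_right_cancel₀ h0 ?_
  simp only [map_neg, map_mul]
  linear_combination (conj u - z * conj u * conj p) * h2 + (z - conj p * z * z) * huu

lemma mob_inv_mob {u p z : ℂ} (hu : ‖u‖ = 1) (hp : ‖p‖ < 1) (hz : ‖z‖ ≤ 1) :
    mob u p (mob (conj u) (-(u * p)) z) = z := by
  have h := mob_mob_inv (u := conj u) (p := -(u * p)) (by simpa using hu)
    (norm_neg_mul_lt hu hp) hz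
  have huu := conj_mul_self_of_norm_eq_one hu
  have e : -(conj u * -(u * p)) = p := by linear_combination p * huu
  rwa [e, Complex.conj_conj] at h

lemma hasDerivAt_mob {p z : ℂ} (u : ℂ) (hp : ‖p‖ < 1) (hz : ‖z‖ ≤ 1) :
    HasDerivAt (mob u p) (u * (1 - ‖p‖ ^ 2) / (1 - conj p * z) ^ 2) z := by
  have h0 := mob_den_ne hp hz
  have h1 : HasDerivAt (fun z => u * (z - p)) (u * 1) z :=
    ((hasDerivAt_id z).sub_const p).const_mul u
  have h2 : HasDerivAt (fun z => 1 - conj p * z) (-(conj p * 1)) z :=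
    ((hasDerivAt_id z).const_mul (conj p)).const_sub 1
  refine (h1.div h2 h0).congr_deriv ?_
  have : (‖p‖ : ℂ) ^ 2 = p * conj p := by rw [Complex.mul_conj']
  rw [this]
  congr 1
  ring

/-- The properties of a disc automorphism that the norm estimates use. They are stable under
composition. -/
structure IsDiscIsometry (φ : ℂ → ℂ) : Prop where
  differentiableOn : DifferentiableOn ℂ φ disc
  bijOn : Set.BijOn φ disc disc
  norm_deriv : ∀ z ∈ disc, ‖deriv φ z‖ * (1 - ‖z‖ ^ 2) = 1 - ‖φ z‖ ^ 2
  -- Needed only for the limit α → -1 in the Hardy estimate, where K disappears from the final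
  -- bound.
  exists_le : ∃ K : ℝ, 0 < K ∧ ∀ z ∈ disc, 1 - ‖z‖ ^ 2 ≤ K * (1 - ‖φ z‖ ^ 2)

namespace IsDiscIsometry

variable {φ χ : ℂ → ℂ}

lemma id : IsDiscIsometry id where
  differentiableOn := differentiableOn_id
  bijOn := Set.bijOn_id _
  norm_deriv z _ := by simp
  exists_le := ⟨1, one_pos, fun z _ => by simp⟩

lemma comp (hχ : IsDiscIsometry χ) (hφ : IsDiscIsometry φ) : IsDiscIsometry (χ ∘ φ) where
  differentiableOn := hχ.differentiableOn.comp hφ.differentiableOn hφ.bijOn.mapsTo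
  bijOn := hχ.bijOn.comp hφ.bijOn
  norm_deriv z hz := by
    have h1 := hφ.differentiableOn.differentiableAt (isOpen_ball.mem_nhds hz)
    have h2 := hχ.differentiableOn.differentiableAt (isOpen_ball.mem_nhds (hφ.bijOn.mapsTo hz))
    rw [deriv_comp z h2 h1, norm_mul, mul_assoc, hφ.norm_deriv z hz,
      hχ.norm_deriv _ (hφ.bijOn.mapsTo hz), Function.comp_apply]
  exists_le := by
    obtain ⟨K, hK, h⟩ := hφ.exists_le
    obtain ⟨K', hK', h'⟩ := hχ.exists_le
    refine ⟨K * K', by positivity, fun z hz => (h z hz).trans ?_⟩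
    rw [mul_assoc]
    exact mul_le_mul_of_nonneg_left (h' _ (hφ.bijOn.mapsTo hz)) hK.le

lemma iterate (hφ : IsDiscIsometry φ) (n : ℕ) : IsDiscIsometry φ^[n] := by
  induction n with
  | zero => exact id
  | succ n ih => rw [Function.iterate_succ']; exact hφ.comp ih

end IsDiscIsometry

lemma isDiscIsometry_mob {u p : ℂ} (hu : ‖u‖ = 1) (hp : ‖p‖ < 1) :
    IsDiscIsometry (mob u p) where
  differentiableOn z hz :=
    (hasDerivAt_mob u hp (mem_disc.1 hz).le).differentiableAt.differentiableWithinAt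
  bijOn := by
    refine Set.InvOn.bijOn (f' := mob (conj u) (-(u * p)))
      ⟨fun z hz => mob_mob_inv hu hp (mem_disc.1 hz).le,
        fun z hz => mob_inv_mob hu hp (mem_disc.1 hz).le⟩
      (fun z hz => mob_mem_disc hu hp hz)
      (fun z hz => mob_mem_disc (by simpa using hu) (norm_neg_mul_lt hu hp) hz)
  norm_deriv z hz := by
    have h1 : 0 < 1 - ‖p‖ ^ 2 := one_sub_norm_sq_pos (mem_disc.2 hp)
    rw [(hasDerivAt_mob u hp (mem_disc.1 hz).le).deriv,
      one_sub_norm_mob_sq hu hp (mem_disc.1 hz).le, norm_div, norm_mul, hu, norm_pow, one_mul]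
    congr 2
    have : ((1 : ℂ) - ‖p‖ ^ 2) = ((1 - ‖p‖ ^ 2 : ℝ) : ℂ) := by push_cast; ring
    rw [this, Complex.norm_real, Real.norm_of_nonneg h1.le]
  exists_le := by
    have h1 : 0 < 1 - ‖p‖ ^ 2 := one_sub_norm_sq_pos (mem_disc.2 hp)
    refine ⟨4 / (1 - ‖p‖ ^ 2), by positivity, fun z hz => ?_⟩
    have hz2 := one_sub_norm_sq_pos hz
    have hz1 := mem_disc.1 hz
    have h3 : 0 < ‖1 - conj p * z‖ := norm_pos_iff.2 (mob_den_ne hp hz1.le)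
    have h4 : ‖1 - conj p * z‖ ≤ 2 := by
      refine (norm_sub_le _ _).trans ?_
      rw [norm_mul, RCLike.norm_conj, norm_one]
      nlinarith [norm_nonneg p, norm_nonneg z]
    rw [one_sub_norm_mob_sq hu hp hz1.le, ← mul_assoc]
    refine le_mul_of_one_le_left hz2.le ?_
    rw [div_mul_div_comm, mul_comm, mul_div_mul_left _ _ h1.ne', one_le_div (by positivity)]
    nlinarith

/-! ### Classification of the automorphisms of the disc -/

/-- Injectivity makes `φ` nowhere locally constant, so `φ` is open and its inverse continuous. The
zeros of `φ'` are isolated, hence the inverse is differentiable on a punctured neighbourhood of each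
point, and the singularity is removable. -/
lemma IsDiscAut.differentiableOn_inv {φ χ : ℂ → ℂ} (hφ : IsDiscAut φ)
    (hχ : Set.InvOn χ φ disc disc) (hm : Set.MapsTo χ disc disc) :
    DifferentiableOn ℂ χ disc := by
  have hopen : IsOpen disc := isOpen_ball
  have han : ∀ z ∈ disc, AnalyticAt ℂ φ z := fun z hz =>
    hφ.1.analyticAt (hopen.mem_nhds hz)
  have hncst : ∀ z ∈ disc, ¬ ∀ᶠ y in 𝓝 z, φ y = φ z := by
    intro z hz h
    have h1 : ∀ᶠ y in 𝓝 z, y = z := by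
      filter_upwards [h, hopen.mem_nhds hz] with y hy hyd
      exact hφ.2.injOn hyd hz hy
    have h2 : ∀ᶠ y in 𝓝[≠] z, y = z := h1.filter_mono nhdsWithin_le_nhds
    obtain ⟨y, hy, hy'⟩ := (h2.and self_mem_nhdsWithin).exists
    exact hy' hy
  have hcont : ∀ w ∈ disc, ContinuousAt χ w := by
    intro w hw
    have hz := hm hw
    have hmap := (han _ hz).eventually_constant_or_nhds_le_map_nhds.resolve_left (hncst _ hz)
    rw [hχ.2 hw] at hmap
    intro V hV
    have h1 : V ∩ disc ∈ 𝓝 (χ w) := inter_mem hV (hopen.mem_nhds hz)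
    have h2 : φ '' (V ∩ disc) ∈ 𝓝 w := hmap (image_mem_map h1)
    refine mem_map.2 (mem_of_superset h2 ?_)
    rintro _ ⟨y, ⟨hyV, hyd⟩, rfl⟩
    simpa [hχ.1 hyd] using hyV
  intro w hw
  have hz := hm hw
  have hd : ∀ᶠ y in 𝓝[≠] (χ w), deriv φ y ≠ 0 := by
    refine (han _ hz).deriv.eventually_eq_zero_or_eventually_ne_zero.resolve_left fun h => ?_
    obtain ⟨r, hr, hball⟩ := Metric.eventually_nhds_iff_ball.1
      (h.and (hopen.mem_nhds hz))
    refine hncst _ hz ?_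
    filter_upwards [ball_mem_nhds _ hr] with y hy
    refine (convex_ball (χ w) r).is_const_of_fderivWithin_eq_zero (𝕜 := ℂ)
      (f := φ) (fun x hx => ((han x (hball x hx).2).differentiableAt).differentiableWithinAt)
      (fun x hx => ?_) hy (mem_ball_self hr)
    rw [fderivWithin_of_isOpen isOpen_ball hx]
    ext
    simpa using (hball x hx).1
  refine (Complex.analyticAt_of_differentiable_on_punctured_nhds_of_continuousAt ?_
    (hcont w hw)).differentiableAt.differentiableWithinAt
  have htend : Tendsto χ (𝓝[≠] w) (𝓝[≠] (χ w)) := by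
    refine tendsto_nhdsWithin_iff.2 ⟨(hcont w hw).tendsto.mono_left nhdsWithin_le_nhds, ?_⟩
    filter_upwards [self_mem_nhdsWithin, mem_nhdsWithin_of_mem_nhds (hopen.mem_nhds hw)]
      with y hy hyd heq
    exact hy (hχ.2.injOn hyd hw heq)
  filter_upwards [htend.eventually hd, mem_nhdsWithin_of_mem_nhds (hopen.mem_nhds hw)]
    with y hy hyd
  refine (HasDerivAt.of_local_left_inverse (f := φ) (f' := deriv φ (χ y)) (hcont y hyd)
    (han _ (hm hyd)).differentiableAt.hasDerivAt hy ?_).differentiableAt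
  filter_upwards [hopen.mem_nhds hyd] with x hx using hχ.2 hx

/-- The Schwarz lemma for the map and for its inverse gives |φ(z)| = |z|; the equality case then
forces linearity. The test point 1/2 below could be any nonzero point of the disc. -/
lemma IsDiscAut.exists_eq_mul {φ : ℂ → ℂ} (hφ : IsDiscAut φ) (h0 : φ 0 = 0) :
    ∃ u : ℂ, ‖u‖ = 1 ∧ ∀ z ∈ disc, φ z = u * z := by
  have hinv := hφ.2.invOn_invFunOn
  have hm : Set.MapsTo (Function.invFunOn φ disc) disc disc := hφ.2.surjOn.mapsTo_invFunOn
  have hd := hφ.differentiableOn_inv hinv hm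
  have h0' : Function.invFunOn φ disc 0 = 0 := by
    have := hinv.1 (show (0 : ℂ) ∈ disc by simp)
    rwa [h0] at this
  have heq : ∀ z ∈ disc, ‖φ z‖ = ‖z‖ := by
    intro z hz
    refine le_antisymm (Complex.norm_le_norm_of_mapsTo_ball hφ.1
      (hφ.2.mapsTo.mono_right ball_subset_closedBall) h0 (mem_disc.1 hz)) ?_
    have := Complex.norm_le_norm_of_mapsTo_ball hd
      (hm.mono_right ball_subset_closedBall) h0'
      (mem_disc.1 (hφ.2.mapsTo hz))
    rwa [hinv.1 hz] at this
  have hhalf : (1 / 2 : ℂ) ∈ disc := by rw [mem_disc]; norm_num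
  have hds : ‖dslope φ 0 (1 / 2)‖ = 1 := by
    rw [dslope_of_ne _ (by norm_num), slope_def_field, h0]
    simp only [sub_zero, norm_div, heq _ hhalf]
    norm_num
  obtain ⟨u, hu, h⟩ := Complex.affine_of_mapsTo_ball_of_exists_norm_dslope_eq_div' (f := φ)
    (c := 0) (R₁ := 1) (R₂ := 1) hφ.1 (by rw [h0]; exact hφ.2.mapsTo.mono_right ball_subset_closedBall)
    ⟨1 / 2, hhalf, by rw [hds]; norm_num⟩
  refine ⟨u, by simpa using hu, fun z hz => ?_⟩
  have := h hz
  simpa [h0, mul_comm] using this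

/-- Precomposition with a Möbius map that sends 0 to the zero p of `φ` reduces to the case of a
fixed origin. -/
theorem IsDiscAut.exists_eq_mob {φ : ℂ → ℂ} (hφ : IsDiscAut φ) :
    ∃ u p : ℂ, ‖u‖ = 1 ∧ ‖p‖ < 1 ∧ ∀ z ∈ disc, φ z = mob u p z := by
  obtain ⟨p, hp, hp0⟩ := hφ.2.surjOn (show (0 : ℂ) ∈ disc by simp)
  have hp1 := mem_disc.1 hp
  have hq1 : ‖-p‖ < 1 := by simpa using hp1
  have hiso := isDiscIsometry_mob (u := 1) (p := -p) (by simp) hq1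
  have haut : IsDiscAut (φ ∘ mob 1 (-p)) :=
    ⟨hφ.1.comp hiso.differentiableOn hiso.bijOn.mapsTo, hφ.2.comp hiso.bijOn⟩
  obtain ⟨u, hu, h⟩ := haut.exists_eq_mul (by simp [mob, hp0])
  refine ⟨u, p, hu, hp1, fun z hz => ?_⟩
  have hz1 : mob 1 p z ∈ disc := mob_mem_disc (by simp) hp1 hz
  have h1 := h _ hz1
  have h2 := mob_mob_inv (u := 1) (by simp) hp1 (mem_disc.1 hz).le
  simp only [map_one, one_mul] at h2
  rw [Function.comp_apply, h2] at h1
  rw [h1, mob, mob, one_mul, mul_div_assoc]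

/-! ### Hyperbolic automorphisms -/

/-- The Möbius coordinate that maps the disc to the right half-plane,
`b` to `0` and `a` to `∞`. -/
def halfPlaneCoord (a b z : ℂ) : ℂ := (a * conj b - 1) * (z - b) / (z - a)

lemma re_mul_conj_lt_one {a b : ℂ} (ha : ‖a‖ = 1) (hb : ‖b‖ = 1) (hab : a ≠ b) :
    (a * conj b).re < 1 := by
  have h : 0 < ‖a - b‖ ^ 2 := by
    have := norm_pos_iff.2 (sub_ne_zero.2 hab)
    positivity
  have ha2 : ‖a‖ ^ 2 = 1 := by rw [ha]; norm_num
  have hb2 : ‖b‖ ^ 2 = 1 := by rw [hb]; norm_num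
  rw [← Complex.normSq_eq_norm_sq, Complex.normSq_apply] at h ha2 hb2
  simp at h ⊢
  nlinarith

lemma ne_of_mem_disc {a z : ℂ} (ha : ‖a‖ = 1) (hz : z ∈ disc) : z ≠ a := by
  rintro rfl
  exact (mem_disc.1 hz).ne ha

/-- Multiplied by |z - a|², the real part equals (1 - Re(a b̄))(1 - |z|²). The factor a b̄ - 1 in
the coordinate is the rotation that makes this work. -/
lemma halfPlaneCoord_re_pos {a b z : ℂ} (ha : ‖a‖ = 1) (hb : ‖b‖ = 1) (hab : a ≠ b)
    (hz : z ∈ disc) : 0 < (halfPlaneCoord a b z).re := by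
  have hza : z - a ≠ 0 := sub_ne_zero.2 (ne_of_mem_disc ha hz)
  have h1 := re_mul_conj_lt_one ha hb hab
  have h2 := one_sub_norm_sq_pos hz
  have h3 : 0 < ‖z - a‖ ^ 2 := by have := norm_pos_iff.2 hza; positivity
  have ha2 : ‖a‖ ^ 2 = 1 := by rw [ha]; norm_num
  have hb2 : ‖b‖ ^ 2 = 1 := by rw [hb]; norm_num
  have key : halfPlaneCoord a b z =
      ((‖z - a‖ ^ 2 : ℝ) : ℂ)⁻¹ * ((a * conj b - 1) * (z - b) * conj (z - a)) := by
    rw [halfPlaneCoord, ← Complex.normSq_eq_norm_sq, ← Complex.mul_conj]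
    have : conj (z - a) ≠ 0 := (map_ne_zero _).2 hza
    field_simp
  have hre : ((a * conj b - 1) * (z - b) * conj (z - a)).re
      = (1 - (a * conj b).re) * (1 - ‖z‖ ^ 2) := by
    rw [← Complex.normSq_eq_norm_sq, Complex.normSq_apply] at ha2 hb2 ⊢
    simp
    linear_combination (b.re ^ 2 + b.im ^ 2 - b.re * z.re - b.im * z.im) * ha2
      + (1 - z.re * a.re - z.im * a.im) * hb2
  rw [key, ← Complex.ofReal_inv, Complex.re_ofReal_mul, hre]
  have : 0 < 1 - (a * conj b).re := by linarith
  positivity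

/-- The data of a hyperbolic disc automorphism `mob u p` with attracting fixed point `a`, repelling
fixed point `b` and multiplier `ρ` at `b`. -/
structure IsHypMob (u p a b : ℂ) (ρ : ℝ) : Prop where
  norm_u : ‖u‖ = 1
  norm_p : ‖p‖ < 1
  norm_a : ‖a‖ = 1
  norm_b : ‖b‖ = 1
  ne : a ≠ b
  map_a : mob u p a = a
  map_b : mob u p b = b
  one_lt : 1 < ρ
  eq_mul : 1 - conj p * a = ρ * (1 - conj p * b)

/-! ### Fixed points and the multiplier -/

section FixedPoints

variable {u p a b : ℂ}

/-- Vieta's formulas for the fixed point equation p̄z² + (u - 1)z - up = 0, written without division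
by p̄. -/
lemma eq_of_mob_fixed (hp : ‖p‖ < 1) (ha : ‖a‖ = 1) (hb : ‖b‖ = 1) (hab : a ≠ b)
    (hfa : mob u p a = a) (hfb : mob u p b = b) :
    u = 1 - conj p * (a + b) ∧ u * p = -(conj p * a * b) := by
  rw [mob, div_eq_iff (mob_den_ne hp ha.le)] at hfa
  rw [mob, div_eq_iff (mob_den_ne hp hb.le)] at hfb
  have hu : u = 1 - conj p * (a + b) := by
    refine mul_right_cancel₀ (sub_ne_zero.2 hab) ?_
    linear_combination hfa - hfb
  refine ⟨hu, ?_⟩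
  linear_combination a * hu - hfa

/-- Gives the exact factor by which the distance to a fixed point changes in one step. Dividing it
by its twin for b linearizes the map in the half-plane coordinate. -/
lemma mob_sub_left_mul {z : ℂ} (hp : ‖p‖ < 1) (ha : ‖a‖ = 1) (hb : ‖b‖ = 1) (hab : a ≠ b)
    (hfa : mob u p a = a) (hfb : mob u p b = b) (hz : ‖z‖ ≤ 1) :
    (mob u p z - a) * (1 - conj p * z) = (z - a) * (1 - conj p * b) := by
  obtain ⟨h1, h2⟩ := eq_of_mob_fixed hp ha hb hab hfa hfb
  rw [sub_mul, mob, div_mul_cancel₀ _ (mob_den_ne hp hz)]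
  linear_combination z * h1 - h2

lemma halfPlaneCoord_mob_mul {z : ℂ} (hp : ‖p‖ < 1) (ha : ‖a‖ = 1) (hb : ‖b‖ = 1) (hab : a ≠ b)
    (hfa : mob u p a = a) (hfb : mob u p b = b) (hz : z ∈ disc) :
    halfPlaneCoord a b (mob u p z) * (1 - conj p * b)
      = (1 - conj p * a) * halfPlaneCoord a b z := by
  have hz1 := (mem_disc.1 hz).le
  have h1 := mob_sub_left_mul hp ha hb hab hfa hfb hz1
  have h2 := mob_sub_left_mul hp hb ha hab.symm hfb hfa hz1
  have h3 := mob_den_ne hp hz1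
  have h4 := mob_den_ne hp hb.le
  have h5 : z - a ≠ 0 := sub_ne_zero.2 (ne_of_mem_disc ha hz)
  have h6 : mob u p z - a ≠ 0 := by
    intro h
    rw [h, zero_mul] at h1
    exact mul_ne_zero h5 h4 h1.symm
  rw [halfPlaneCoord, halfPlaneCoord, div_mul_eq_mul_div, mul_div_assoc', div_eq_div_iff h6 h5]
  refine mul_right_cancel₀ h3 ?_
  linear_combination (a * conj b - 1) * (1 - conj p * b) * (z - a) * h2
    - (1 - conj p * a) * (a * conj b - 1) * (z - b) * h1

end FixedPoints

lemma neBot_nhdsWithin_disc {a : ℂ} (ha : ‖a‖ = 1) : (𝓝[disc] a).NeBot := by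
  rw [← mem_closure_iff_nhdsWithin_neBot, closure_ball _ one_ne_zero]
  simp [ha]

/-- In the half-plane coordinate the map is multiplication by a constant c. It is real because 1 -
p̄x = u·conj(1 - p̄x) at both fixed points x, and positive because it carries a point of the right
half-plane to another. If c ≤ 1, then w would stay bounded on the orbit of 0, which converges to the
pole a of w. -/
theorem exists_isHypMob {φ : ℂ → ℂ} {a b : ℂ} (hφ : IsDiscAut φ) (ha : IsDenjoyWolffPt φ a)
    (hb : IsBoundaryFixedPt φ b) (hba : b ≠ a) :
    ∃ (u p : ℂ) (ρ : ℝ), IsHypMob u p a b ρ ∧ ∀ z ∈ disc, φ z = mob u p z := by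
  obtain ⟨u, p, hu, hp, hφm⟩ := hφ.exists_eq_mob
  have ha1 : ‖a‖ = 1 := by simpa using ha.1
  have hb1 : ‖b‖ = 1 := by simpa using hb.1
  have h0 : (0 : ℂ) ∈ disc := by simp
  have horb : ∀ n : ℕ, φ^[n] 0 ∈ disc := fun n => (hφ.2.mapsTo.iterate n) h0
  have hlim : Tendsto (fun n : ℕ => φ^[n] 0) atTop (𝓝 a) := ha.2.tendsto_at h0
  have hfa : mob u p a = a := by
    have h1 : Tendsto (fun n : ℕ => mob u p (φ^[n] 0)) atTop (𝓝 (mob u p a)) :=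
      (hasDerivAt_mob u hp ha1.le).continuousAt.tendsto.comp hlim
    refine tendsto_nhds_unique h1 (((tendsto_add_atTop_iff_nat 1).2 hlim).congr fun n => ?_)
    rw [Function.iterate_succ_apply', hφm _ (horb n)]
  have hfb : mob u p b = b := by
    have := neBot_nhdsWithin_disc hb1
    have h1 : Tendsto (mob u p) (𝓝[disc] b) (𝓝 (mob u p b)) :=
      (hasDerivAt_mob u hp hb1.le).continuousAt.tendsto.mono_left nhdsWithin_le_nhds
    refine tendsto_nhds_unique h1 (hb.2.congr' ?_)
    filter_upwards [self_mem_nhdsWithin] with z hz using hφm z hz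
  have hX := mob_den_ne hp ha1.le
  have hY := mob_den_ne hp hb1.le
  set c : ℂ := (1 - conj p * a) / (1 - conj p * b) with hc
  have hw : ∀ z ∈ disc, halfPlaneCoord a b (φ z) = c * halfPlaneCoord a b z := by
    intro z hz
    rw [hφm z hz, hc, div_mul_eq_mul_div, eq_div_iff hY]
    exact halfPlaneCoord_mob_mul hp ha1 hb1 hba.symm hfa hfb hz
  have hconj : ∀ x : ℂ, ‖x‖ = 1 → mob u p x = x → 1 - conj p * x = u * conj (1 - conj p * x) := by
    intro x hx hf
    rw [mob, div_eq_iff (mob_den_ne hp hx.le)] at hf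
    have := conj_mul_self_of_norm_eq_one hx
    simp only [map_sub, map_one, map_mul, Complex.conj_conj]
    linear_combination -(conj x) * hf + (u - (1 - conj p * x)) * this
  have hcc : conj c = c := by
    have hu0 : u ≠ 0 := by rintro rfl; simp at hu
    rw [hc, map_div₀]
    conv_rhs => rw [hconj a ha1 hfa, hconj b hb1 hfb, mul_div_mul_left _ _ hu0]
  obtain ⟨ρ, hρ⟩ := Complex.conj_eq_iff_real.1 hcc
  have hpos : 0 < ρ := by
    have h1 := halfPlaneCoord_re_pos ha1 hb1 hba.symm (hφ.2.mapsTo h0)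
    have h2 := halfPlaneCoord_re_pos ha1 hb1 hba.symm h0
    rw [hw 0 h0, hρ, Complex.re_ofReal_mul] at h1
    exact pos_of_mul_pos_left h1 h2.le
  refine ⟨u, p, ρ, ⟨hu, hp, ha1, hb1, hba.symm, hfa, hfb, ?_, ?_⟩, hφm⟩
  · by_contra! hle
    have hwn : ∀ n : ℕ, halfPlaneCoord a b (φ^[n] 0) = (ρ : ℂ) ^ n * halfPlaneCoord a b 0 := by
      intro n
      induction n with
      | zero => simp
      | succ n ih => rw [Function.iterate_succ_apply', hw _ (horb n), ih, hρ]; ring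
    have h1 : Tendsto (fun n : ℕ => (a * conj b - 1) * (φ^[n] 0 - b)) atTop
        (𝓝 ((a * conj b - 1) * (a - b))) := (hlim.sub_const b).const_mul _
    have h2 : Tendsto (fun n : ℕ => (a * conj b - 1) * (φ^[n] 0 - b)) atTop (𝓝 0) := by
      have h3 : Tendsto (fun n : ℕ => ‖halfPlaneCoord a b 0‖ * ‖φ^[n] 0 - a‖) atTop (𝓝 0) := by
        simpa using (hlim.sub_const a).norm.const_mul ‖halfPlaneCoord a b 0‖
      refine squeeze_zero_norm (fun n => ?_) h3
      have h4 : φ^[n] 0 - a ≠ 0 := sub_ne_zero.2 (ne_of_mem_disc ha1 (horb n))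
      have h5 : (a * conj b - 1) * (φ^[n] 0 - b) = halfPlaneCoord a b (φ^[n] 0) * (φ^[n] 0 - a) := by
        rw [halfPlaneCoord, div_mul_cancel₀ _ h4]
      rw [h5, hwn n, norm_mul, norm_mul, norm_pow, Complex.norm_real, Real.norm_of_nonneg hpos.le]
      gcongr
      exact mul_le_of_le_one_left (norm_nonneg _) (pow_le_one₀ hpos.le hle)
    have h6 := tendsto_nhds_unique h1 h2
    have h7 := re_mul_conj_lt_one ha1 hb1 hba.symm
    rcases mul_eq_zero.1 h6 with h | h
    · rw [sub_eq_zero.1 h] at h7; simp at h7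
    · exact hba (sub_eq_zero.1 h).symm
  · rw [← hρ, hc, div_mul_cancel₀ _ hY]

/-! ### Derivatives at the fixed points and growth along orbits -/

namespace IsHypMob

variable {u p a b : ℂ} {ρ : ℝ} (H : IsHypMob u p a b ρ)
include H

lemma isDiscIsometry : IsDiscIsometry (mob u p) := isDiscIsometry_mob H.norm_u H.norm_p

lemma map_mem {z : ℂ} (hz : z ∈ disc) : mob u p z ∈ disc := mob_mem_disc H.norm_u H.norm_p hz

lemma pos : 0 < ρ := one_pos.trans H.one_lt

/-- The right side is the numerator of the derivative of `mob u p`, so at a fixed point the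
derivative becomes a ratio of the two denominators, that is, ρ or ρ⁻¹. -/
lemma mul_eq : (1 - conj p * a) * (1 - conj p * b) = u * (1 - ‖p‖ ^ 2) := by
  obtain ⟨h1, h2⟩ := eq_of_mob_fixed H.norm_p H.norm_a H.norm_b H.ne H.map_a H.map_b
  have : (‖p‖ : ℂ) ^ 2 = p * conj p := by rw [Complex.mul_conj']
  rw [this]
  linear_combination conj p * h2 - h1

lemma hasDerivAt_right : HasDerivAt (mob u p) ρ b := by
  have hY := mob_den_ne H.norm_p H.norm_b.le
  refine (hasDerivAt_mob u H.norm_p H.norm_b.le).congr_deriv ?_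
  rw [← H.mul_eq, H.eq_mul, div_eq_iff (pow_ne_zero 2 hY)]
  ring

lemma hasDerivAt_left : HasDerivAt (mob u p) (ρ : ℂ)⁻¹ a := by
  have hY := mob_den_ne H.norm_p H.norm_b.le
  have hρ : (ρ : ℂ) ≠ 0 := by exact_mod_cast H.pos.ne'
  refine (hasDerivAt_mob u H.norm_p H.norm_a.le).congr_deriv ?_
  rw [← H.mul_eq, H.eq_mul]
  field_simp

/-- The inverse map attracts to b with the same multiplier, so each estimate for forward orbits also
serves for backward ones. -/
lemma symm : IsHypMob (conj u) (-(u * p)) b a ρ where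
  norm_u := by simpa using H.norm_u
  norm_p := norm_neg_mul_lt H.norm_u H.norm_p
  norm_a := H.norm_b
  norm_b := H.norm_a
  ne := H.ne.symm
  map_a := by
    have := mob_mob_inv H.norm_u H.norm_p H.norm_b.le
    rwa [H.map_b] at this
  map_b := by
    have := mob_mob_inv H.norm_u H.norm_p H.norm_a.le
    rwa [H.map_a] at this
  one_lt := H.one_lt
  eq_mul := by
    have key : ∀ x : ℂ, ‖x‖ = 1 → mob u p x = x →
        (1 - conj (-(u * p)) * x) * (1 - conj p * x) = 1 - conj p * p := by
      intro x hx hf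
      rw [mob, div_eq_iff (mob_den_ne H.norm_p hx.le)] at hf
      have := conj_mul_self_of_norm_eq_one H.norm_u
      simp only [map_neg, map_mul]
      linear_combination -(conj u * conj p) * hf + conj p * (x - p) * this
    have hY := mob_den_ne H.norm_p H.norm_b.le
    refine mul_right_cancel₀ hY ?_
    rw [key b H.norm_b H.map_b, ← key a H.norm_a H.map_a, H.eq_mul]
    ring

/-- The quotient |1 - p̄z|²/(1 - |p|²) is 1/|φ'(z)|, the base of the power in `growth`. -/
lemma norm_sq_div_left : ‖1 - conj p * a‖ ^ 2 / (1 - ‖p‖ ^ 2) = ρ := by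
  have h := congrArg norm H.mul_eq
  have h1 : 0 < 1 - ‖p‖ ^ 2 := one_sub_norm_sq_pos (mem_disc.2 H.norm_p)
  have : ((1 : ℂ) - ‖p‖ ^ 2) = ((1 - ‖p‖ ^ 2 : ℝ) : ℂ) := by push_cast; ring
  rw [this, norm_mul, norm_mul, H.norm_u, one_mul, Complex.norm_real,
    Real.norm_of_nonneg h1.le] at h
  have h2 := congrArg norm H.eq_mul
  rw [norm_mul, Complex.norm_real, Real.norm_of_nonneg H.pos.le] at h2
  rw [div_eq_iff h1.ne', ← h, h2]
  ring

lemma norm_sq_div_right : ‖1 - conj p * b‖ ^ 2 / (1 - ‖p‖ ^ 2) = ρ⁻¹ := by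
  have h2 := congrArg norm H.eq_mul
  rw [norm_mul, Complex.norm_real, Real.norm_of_nonneg H.pos.le] at h2
  have h := H.norm_sq_div_left
  rw [h2, mul_pow, mul_div_assoc] at h
  have := H.pos.ne'
  refine mul_left_cancel₀ (pow_ne_zero 2 this) ?_
  rw [h]
  field_simp

lemma halfPlaneCoord_map {z : ℂ} (hz : z ∈ disc) :
    halfPlaneCoord a b (mob u p z) = ρ * halfPlaneCoord a b z := by
  have h := halfPlaneCoord_mob_mul H.norm_p H.norm_a H.norm_b H.ne H.map_a H.map_b hz
  have hY := mob_den_ne H.norm_p H.norm_b.le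
  refine mul_right_cancel₀ hY ?_
  rw [h, H.eq_mul]
  ring

lemma iterate_mem {z : ℂ} (hz : z ∈ disc) (n : ℕ) : (mob u p)^[n] z ∈ disc :=
  (Set.MapsTo.iterate (fun _ h => H.map_mem h) n) hz

lemma halfPlaneCoord_iterate {z : ℂ} (hz : z ∈ disc) (n : ℕ) :
    halfPlaneCoord a b ((mob u p)^[n] z) = ρ ^ n * halfPlaneCoord a b z := by
  induction n with
  | zero => simp
  | succ n ih =>
    rw [Function.iterate_succ_apply', H.halfPlaneCoord_map (H.iterate_mem hz n), ih]; ring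

lemma halfPlaneCoord_norm_pos {z : ℂ} (hz : z ∈ disc) : 0 < ‖halfPlaneCoord a b z‖ :=
  (halfPlaneCoord_re_pos H.norm_a H.norm_b H.ne hz).trans_le (Complex.re_le_norm _)

lemma tendsto_left : Tendsto (mob u p) (𝓝[disc] a) (𝓝[disc] a) := by
  refine tendsto_nhdsWithin_iff.2 ⟨?_, ?_⟩
  · have := H.hasDerivAt_left.continuousAt.tendsto
    rw [H.map_a] at this
    exact this.mono_left nhdsWithin_le_nhds
  · filter_upwards [self_mem_nhdsWithin] with z hz using H.map_mem hz

lemma tendsto_right : Tendsto (mob u p) (𝓝[disc] b) (𝓝[disc] b) := by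
  refine tendsto_nhdsWithin_iff.2 ⟨?_, ?_⟩
  · have := H.hasDerivAt_right.continuousAt.tendsto
    rw [H.map_b] at this
    exact this.mono_left nhdsWithin_le_nhds
  · filter_upwards [self_mem_nhdsWithin] with z hz using H.map_mem hz

lemma exists_forall_of_nhdsWithin {P : ℂ → Prop} (hPa : ∀ᶠ z in 𝓝[disc] a, P z)
    (hPb : ∀ᶠ z in 𝓝[disc] b, P z) :
    ∃ A : ℝ, 1 < A ∧ ∀ z ∈ disc,
      (‖halfPlaneCoord a b z‖ < A⁻¹ ∨ A < ‖halfPlaneCoord a b z‖) → P z := by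
  obtain ⟨r, hr, h1⟩ := Metric.eventually_nhds_iff_ball.1 (eventually_nhdsWithin_iff.1 hPa)
  obtain ⟨s, hs, h2⟩ := Metric.eventually_nhds_iff_ball.1 (eventually_nhdsWithin_iff.1 hPb)
  have hc : 0 < ‖a * conj b - 1‖ := by
    refine norm_pos_iff.2 fun h => ?_
    have := re_mul_conj_lt_one H.norm_a H.norm_b H.ne
    rw [sub_eq_zero.1 h] at this
    simp at this
  set c := ‖a * conj b - 1‖ with hcdef
  -- Since |w| = c|z - b|/|z - a| and both distances are below 2, A ≥ 2c/r makes |w| > A force |z -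
  -- a| < r, and A ≥ 2/(cs) makes |w| < A⁻¹ force |z - b| < s.
  set A : ℝ := 1 + 1 + 2 * c / r + 2 / (c * s) with hA
  have hp1 : 0 < 2 * c / r := by positivity
  have hp2 : 0 < 2 / (c * s) := by positivity
  have hA1 : 1 < A := by linarith
  have hA0 : 0 < A := by linarith
  refine ⟨A, hA1, fun z hz h => ?_⟩
  have hz1 := mem_disc.1 hz
  have hza : 0 < ‖z - a‖ := norm_pos_iff.2 (sub_ne_zero.2 (ne_of_mem_disc H.norm_a hz))
  have hza2 : ‖z - a‖ < 2 := by
    have := norm_sub_le z a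
    rw [H.norm_a] at this; linarith
  have hzb2 : ‖z - b‖ < 2 := by
    have := norm_sub_le z b
    rw [H.norm_b] at this; linarith
  have hval : ‖halfPlaneCoord a b z‖ = c * ‖z - b‖ / ‖z - a‖ := by
    rw [halfPlaneCoord, norm_div, norm_mul]
  rw [hval] at h
  rcases h with h | h
  · refine h2 z ?_ hz
    rw [mem_ball, dist_eq_norm]
    rw [div_lt_iff₀ hza, inv_mul_eq_div, lt_div_iff₀ hA0] at h
    have h3 : 2 / (c * s) ≤ A := by linarith
    rw [div_le_iff₀ (by positivity)] at h3
    by_contra! hcon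
    have h4 : A * (c * s) ≤ A * (c * ‖z - b‖) := by gcongr
    linarith
  · refine h1 z ?_ hz
    rw [mem_ball, dist_eq_norm]
    rw [lt_div_iff₀ hza] at h
    have h3 : 2 * c / r ≤ A := by linarith
    rw [div_le_iff₀ hr] at h3
    by_contra! hcon
    have h4 : A * r ≤ A * ‖z - a‖ := by gcongr
    have h5 : c * ‖z - b‖ ≤ c * 2 := by gcongr
    linarith

/-- A product of a bounded function along the orbits of a hyperbolic automorphism grows at most
like the powers of any number that bounds the function near the two fixed points. -/
theorem prod_le {Q : ℂ → ℝ} {K R : ℝ} (hR : 0 < R) (hQ0 : ∀ z ∈ disc, 0 ≤ Q z)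
    (hQK : ∀ z ∈ disc, Q z ≤ K) (hQa : ∀ᶠ z in 𝓝[disc] a, Q z ≤ R)
    (hQb : ∀ᶠ z in 𝓝[disc] b, Q z ≤ R) :
    ∃ C : ℝ, 0 < C ∧ ∀ n : ℕ, ∀ z ∈ disc,
      ∏ j ∈ Finset.range n, Q ((mob u p)^[j] z) ≤ C * R ^ n := by
  obtain ⟨A, hA1, hA⟩ := H.exists_forall_of_nhdsWithin hQa hQb
  have hA0 : 0 < A := by linarith
  obtain ⟨k, hk⟩ := pow_unbounded_of_one_lt (K / R) H.one_lt
  have hρ := H.pos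
  have hlo : 0 < A⁻¹ := inv_pos.2 hA0
  have hlohi : A⁻¹ ≤ ρ * A := by
    have h1 : A⁻¹ ≤ 1 := inv_le_one_of_one_le₀ hA1.le
    nlinarith [H.one_lt]
  -- A Lyapunov weight with Q·v ≤ R·(v ∘ φ). Where |w| lies outside [A⁻¹, A], Q ≤ R and v does not
  -- decrease; inside, v gains the factor ρ^k > K/R. The upper cut is ρA, not A, so that the image
  -- of a point with |w| ≤ A is not truncated. As v is bounded above and below, iteration bounds the
  -- product.
  set v : ℂ → ℝ := fun z => (max A⁻¹ (min ‖halfPlaneCoord a b z‖ (ρ * A))) ^ k with hv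
  have hvlo : ∀ z, (A⁻¹) ^ k ≤ v z := fun z => by
    simp only [hv]; gcongr; exact le_max_left _ _
  have hvhi : ∀ z, v z ≤ (ρ * A) ^ k := fun z => by
    simp only [hv]
    have : 0 ≤ max A⁻¹ (min ‖halfPlaneCoord a b z‖ (ρ * A)) := hlo.le.trans (le_max_left _ _)
    gcongr
    exact max_le hlohi (min_le_right _ _)
  have hvpos : ∀ z, 0 < v z := fun z => (by positivity : 0 < (A⁻¹) ^ k).trans_le (hvlo z)
  have step : ∀ z ∈ disc, Q z * v z ≤ R * v (mob u p z) := by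
    intro z hz
    have hw : ‖halfPlaneCoord a b (mob u p z)‖ = ρ * ‖halfPlaneCoord a b z‖ := by
      rw [H.halfPlaneCoord_map hz, norm_mul, Complex.norm_real, Real.norm_of_nonneg hρ.le]
    set t := ‖halfPlaneCoord a b z‖ with ht
    have ht0 : 0 ≤ t := norm_nonneg _
    have hmono : t ≤ ρ * t := le_mul_of_one_le_left ht0 H.one_lt.le
    by_cases hcase : t < A⁻¹ ∨ A < t
    · have h1 := hA z hz hcase
      have h2 : v z ≤ v (mob u p z) := by
        simp only [hv, hw, ← ht]; gcongr
      exact mul_le_mul h1 h2 (hvpos z).le hR.le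
    · push Not at hcase
      obtain ⟨hc1, hc2⟩ := hcase
      have e1 : v z = t ^ k := by
        simp only [hv, ← ht]
        rw [min_eq_left (by nlinarith [H.one_lt]), max_eq_right hc1]
      have e2 : v (mob u p z) = (ρ * t) ^ k := by
        simp only [hv, hw]
        rw [min_eq_left (by gcongr), max_eq_right (hc1.trans hmono)]
      rw [e1, e2, mul_pow, ← mul_assoc]
      have h3 : Q z ≤ R * ρ ^ k := by
        rw [div_lt_iff₀ hR] at hk
        linarith [hQK z hz]
      gcongr
  have main : ∀ n : ℕ, ∀ z ∈ disc,
      (∏ j ∈ Finset.range n, Q ((mob u p)^[j] z)) * v z ≤ R ^ n * v ((mob u p)^[n] z) := by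
    intro n
    induction n with
    | zero => intro z _; simp
    | succ n ih =>
      intro z hz
      have hn := H.iterate_mem hz n
      rw [Finset.prod_range_succ, Function.iterate_succ_apply']
      calc _ = Q ((mob u p)^[n] z) * ((∏ j ∈ Finset.range n, Q ((mob u p)^[j] z)) * v z) := by ring
        _ ≤ Q ((mob u p)^[n] z) * (R ^ n * v ((mob u p)^[n] z)) :=
          mul_le_mul_of_nonneg_left (ih z hz) (hQ0 _ hn)
        _ = R ^ n * (Q ((mob u p)^[n] z) * v ((mob u p)^[n] z)) := by ring
        _ ≤ R ^ n * (R * v (mob u p ((mob u p)^[n] z))) :=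
          mul_le_mul_of_nonneg_left (step _ hn) (by positivity)
        _ = _ := by ring
  refine ⟨(ρ * A) ^ k / (A⁻¹) ^ k, by positivity, fun n z hz => ?_⟩
  have h1 := main n z hz
  have h2 : 0 ≤ ∏ j ∈ Finset.range n, Q ((mob u p)^[j] z) :=
    Finset.prod_nonneg fun j _ => hQ0 _ (H.iterate_mem hz j)
  rw [div_mul_eq_mul_div, le_div_iff₀ (by positivity)]
  calc _ ≤ (∏ j ∈ Finset.range n, Q ((mob u p)^[j] z)) * v z :=
        mul_le_mul_of_nonneg_left (hvlo z) h2
    _ ≤ _ := h1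
    _ ≤ R ^ n * (ρ * A) ^ k := mul_le_mul_of_nonneg_left (hvhi _) (by positivity)
    _ = _ := by ring

end IsHypMob

/-! ### Criteria for membership in the spectrum -/

section SpectrumCriteria

variable {E : Type*} [NormedAddCommGroup E] [NormedSpace ℂ E]

/-- The sum L(f) over n ∈ ℤ satisfies L(Uf) = l·L(f) by a shift of the index, so it vanishes on the
range of l - U, while L(h) = e(h) ≠ 0. Hence l - U is not onto. Continuity of L is not needed. -/
lemma mem_spectrum_of_summable_functional (U : (E →L[ℂ] E)ˣ) {l : ℂ} (hl : l ≠ 0) (e : E →L[ℂ] ℂ)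
    (hsum : ∀ f : E, Summable fun n : ℤ => l ^ (-n) * e ((U ^ n : (E →L[ℂ] E)ˣ).val f))
    {h : E} (h0 : e h ≠ 0) (hn : ∀ n : ℤ, n ≠ 0 → e ((U ^ n : (E →L[ℂ] E)ˣ).val h) = 0) :
    l ∈ spectrum ℂ (U : E →L[ℂ] E) := by
  rw [spectrum.mem_iff]
  rintro ⟨V, hV⟩
  set g : E := (V⁻¹ : (E →L[ℂ] E)ˣ).val h with hg
  have hg1 : h = l • g - (U : E →L[ℂ] E) g := by
    have h1 : (V : E →L[ℂ] E) g = h := by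
      rw [hg, ← mul_apply_eq_comp, Units.mul_inv, one_apply_eq_self]
    rw [← h1, hV]
    simp [Algebra.algebraMap_eq_smul_one]
  set L : E → ℂ := fun f => ∑' n : ℤ, l ^ (-n) * e ((U ^ n : (E →L[ℂ] E)ˣ).val f) with hL
  have hLh : L h = e h := by
    rw [hL]
    simp only
    rw [tsum_eq_single 0 (fun n hn0 => by rw [hn n hn0, mul_zero])]
    simp
  have hshift : L ((U : E →L[ℂ] E) g) = l * L g := by
    rw [hL]
    simp only
    rw [← tsum_mul_left, ← (Equiv.addRight (1 : ℤ)).tsum_eq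
      (fun n : ℤ => l * (l ^ (-n) * e ((U ^ n : (E →L[ℂ] E)ˣ).val g)))]
    refine tsum_congr fun n => ?_
    simp only [Equiv.coe_addRight]
    rw [zpow_add_one U, Units.val_mul, mul_apply_eq_comp, neg_add, zpow_add₀ hl,
      zpow_neg_one]
    field_simp
  have hsub : L h = l * L g - L ((U : E →L[ℂ] E) g) := by
    rw [hL]
    simp only
    rw [← tsum_mul_left, ← ((hsum g).mul_left l).tsum_sub (hsum _)]
    refine tsum_congr fun n => ?_
    rw [hg1, map_sub, map_sub, map_smul, map_smul, smul_eq_mul]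
    ring
  rw [hshift, sub_self, hLh] at hsub
  exact h0 hsub

/-- The sum of the series is an eigenvector for l, nonzero because e takes the value e(h) on it. -/
lemma mem_spectrum_of_summable_orbit (U : (E →L[ℂ] E)ˣ) {l : ℂ} (hl : l ≠ 0) (e : E →L[ℂ] ℂ)
    {h : E} (hsum : Summable fun n : ℤ => l ^ (-n) • (U ^ n : (E →L[ℂ] E)ˣ).val h)
    (h0 : e h ≠ 0) (hn : ∀ n : ℤ, n ≠ 0 → e ((U ^ n : (E →L[ℂ] E)ˣ).val h) = 0) :
    l ∈ spectrum ℂ (U : E →L[ℂ] E) := by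
  rw [spectrum.mem_iff]
  rintro ⟨V, hV⟩
  set F : E := ∑' n : ℤ, l ^ (-n) • (U ^ n : (E →L[ℂ] E)ˣ).val h with hF
  have hUF : (U : E →L[ℂ] E) F = l • F := by
    rw [hF, (U : E →L[ℂ] E).map_tsum hsum, ← hsum.tsum_const_smul,
      ← (Equiv.addRight (1 : ℤ)).tsum_eq
        (fun n : ℤ => l • (l ^ (-n) • (U ^ n : (E →L[ℂ] E)ˣ).val h))]
    refine tsum_congr fun n => ?_
    simp only [Equiv.coe_addRight]
    rw [map_smul, add_comm n 1, zpow_add U, zpow_one, Units.val_mul,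
      mul_apply_eq_comp, neg_add, zpow_add₀ hl, zpow_neg_one, smul_smul,
      mul_inv_cancel_left₀ hl]
  have heF : e F = e h := by
    rw [hF, e.map_tsum hsum, tsum_eq_single 0 (fun n hn0 => by rw [map_smul, hn n hn0, smul_zero])]
    simp
  have hVF : (V : E →L[ℂ] E) F = 0 := by
    rw [hV]
    simp [Algebra.algebraMap_eq_smul_one, hUF]
  have hF0 : F = 0 := by
    have : (V⁻¹ : (E →L[ℂ] E)ˣ).val ((V : E →L[ℂ] E) F) = F := by
      rw [← mul_apply_eq_comp, Units.inv_mul, one_apply_eq_self]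
    rw [← this, hVF, map_zero]
  rw [hF0, map_zero] at heF
  exact h0 heF.symm

/-- lⁿ lies in the spectrum of Tⁿ, so (|l|/R)ⁿ stays bounded. -/
lemma norm_le_of_norm_pow_le [CompleteSpace E] {T : E →L[ℂ] E} {C R : ℝ}
    (hR : 0 < R) (hT : ∀ n : ℕ, ‖T ^ n‖ ≤ C * R ^ n) {l : ℂ} (hl : l ∈ spectrum ℂ T) :
    ‖l‖ ≤ R := by
  by_contra! h
  have h1 : ∀ n : ℕ, (‖l‖ / R) ^ n ≤ C * ‖(1 : E →L[ℂ] E)‖ := by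
    intro n
    have h2 := spectrum.norm_le_norm_mul_of_mem (spectrum.pow_mem_pow T n hl)
    rw [norm_pow] at h2
    rw [div_pow, div_le_iff₀ (by positivity)]
    calc _ ≤ _ := h2
      _ ≤ (C * R ^ n) * ‖(1 : E →L[ℂ] E)‖ := by gcongr; exact hT n
      _ = _ := by ring
  obtain ⟨n, hn⟩ := pow_unbounded_of_one_lt (C * ‖(1 : E →L[ℂ] E)‖) ((one_lt_div hR).2 h)
  exact absurd (h1 n) (not_le.2 hn)

end SpectrumCriteria

/-! ### Spaces of holomorphic functions -/

/-- A normed space of holomorphic functions on the disc on which weighted composition operators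
with disc automorphisms satisfy the same norm estimate as in a weighted Bergman space: the norm is
at most the supremum of `|ψ| |φ'|^{-γ}`. -/
structure DiscSpace (E : Type*) [NormedAddCommGroup E] [NormedSpace ℂ E] (γ : ℝ) where
  ev : E →ₗ[ℂ] (ℂ → ℂ)
  ev_injective : Function.Injective ev
  ev_mem : ∀ f, ev f ∈ holo
  pos : 0 < γ
  exists_comp : ∀ (φ ψ : ℂ → ℂ) (M : ℝ), IsDiscIsometry φ → DifferentiableOn ℂ ψ disc → 0 ≤ M →
    (∀ z ∈ disc, ‖ψ z‖ * (1 - ‖z‖ ^ 2) ^ γ ≤ M * (1 - ‖φ z‖ ^ 2) ^ γ) →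
    ∀ f, ∃ g, (∀ z ∈ disc, ev g z = ψ z * ev f (φ z)) ∧ ‖g‖ ≤ M * ‖f‖
  exists_one : ∃ g, ∀ z ∈ disc, ev g z = 1
  exists_norm_zero_le : ∃ C, ∀ f, ‖ev f 0‖ ≤ C * ‖f‖

namespace DiscSpace

variable {E : Type*} [NormedAddCommGroup E] [NormedSpace ℂ E] {γ : ℝ} (S : DiscSpace E γ)
include S

lemma ext {f g : E} (h : ∀ z ∈ disc, S.ev f z = S.ev g z) : f = g := by
  refine S.ev_injective (funext fun z => ?_)
  by_cases hz : z ∈ disc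
  · exact h z hz
  · rw [(S.ev_mem f).2 z hz, (S.ev_mem g).2 z hz]

lemma exists_clm {φ ψ : ℂ → ℂ} {M : ℝ} (hφ : IsDiscIsometry φ) (hψ : DifferentiableOn ℂ ψ disc)
    (hM : 0 ≤ M) (h : ∀ z ∈ disc, ‖ψ z‖ * (1 - ‖z‖ ^ 2) ^ γ ≤ M * (1 - ‖φ z‖ ^ 2) ^ γ) :
    ∃ T : E →L[ℂ] E, (∀ f, ∀ z ∈ disc, S.ev (T f) z = ψ z * S.ev f (φ z)) ∧ ‖T‖ ≤ M := by
  choose T hT hTn using S.exists_comp φ ψ M hφ hψ hM h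
  let L : E →ₗ[ℂ] E :=
    { toFun := T
      map_add' := fun f g => S.ext fun z hz => by
        simp only [map_add, Pi.add_apply, hT _ z hz]; ring
      map_smul' := fun c f => S.ext fun z hz => by
        simp only [map_smul, Pi.smul_apply, hT _ z hz, RingHom.id_apply, smul_eq_mul]; ring }
  exact ⟨L.mkContinuous M hTn, fun f z hz => hT f z hz, L.mkContinuous_norm_le hM hTn⟩

/-- Composition with a Möbius map that sends 0 to z reduces to the bound at 0; by `exists_comp` its
norm is at most (4/(1 - |z|²))^γ. -/
lemma exists_norm_le : ∃ C : ℝ, 0 < C ∧ ∀ f, ∀ z ∈ disc,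
    ‖S.ev f z‖ * (1 - ‖z‖ ^ 2) ^ γ ≤ C * ‖f‖ := by
  obtain ⟨C, hC⟩ := S.exists_norm_zero_le
  refine ⟨(|C| + 1) * 4 ^ γ, by positivity, fun f z hz => ?_⟩
  have hz1 := mem_disc.1 hz
  have hz2 := one_sub_norm_sq_pos hz
  have hnz : ‖-z‖ < 1 := by simpa using hz1
  have hM : 0 ≤ (4 / (1 - ‖z‖ ^ 2)) ^ γ := by positivity
  obtain ⟨g, hg, hgn⟩ := S.exists_comp (mob 1 (-z)) (fun _ => 1) ((4 / (1 - ‖z‖ ^ 2)) ^ γ)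
    (isDiscIsometry_mob (by simp) hnz) (differentiableOn_const _) hM (by
      intro x hx
      have hx1 := mem_disc.1 hx
      have hx2 := one_sub_norm_sq_pos hx
      have hm := one_sub_norm_sq_pos (mob_mem_disc (u := 1) (by simp) hnz hx)
      rw [norm_one, one_mul, ← Real.mul_rpow (by positivity) hm.le]
      refine Real.rpow_le_rpow hx2.le ?_ S.pos.le
      rw [one_sub_norm_mob_sq (by simp) hnz hx1.le, norm_neg, ← mul_assoc]
      refine le_mul_of_one_le_left hx2.le ?_
      have h3 : 0 < ‖1 - conj (-z) * x‖ := norm_pos_iff.2 (mob_den_ne hnz hx1.le)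
      have h4 : ‖1 - conj (-z) * x‖ ≤ 2 := by
        refine (norm_sub_le _ _).trans ?_
        rw [norm_mul, RCLike.norm_conj, norm_one, norm_neg]
        nlinarith [norm_nonneg x, norm_nonneg z]
      rw [div_mul_div_comm, mul_comm, mul_div_mul_left _ _ hz2.ne', one_le_div (by positivity)]
      nlinarith) f
  have h0 := hg 0 (by simp)
  have hm0 : mob 1 (-z) 0 = z := by simp [mob]
  rw [one_mul, hm0] at h0
  rw [← h0]
  have hpow : 0 < (1 - ‖z‖ ^ 2) ^ γ := Real.rpow_pos_of_pos hz2 _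
  calc ‖S.ev g 0‖ * (1 - ‖z‖ ^ 2) ^ γ
      ≤ ((|C| + 1) * ((4 / (1 - ‖z‖ ^ 2)) ^ γ * ‖f‖)) * (1 - ‖z‖ ^ 2) ^ γ := by
        gcongr
        calc _ ≤ C * ‖g‖ := hC g
          _ ≤ (|C| + 1) * ‖g‖ := by gcongr; linarith [le_abs_self C]
          _ ≤ _ := by gcongr
    _ = (|C| + 1) * 4 ^ γ * ‖f‖ := by
        rw [Real.div_rpow (by norm_num) hz2.le]
        field_simp

/-- Evaluation at a point of the disc is continuous. -/
lemma exists_evCLM {z : ℂ} (hz : z ∈ disc) : ∃ e : E →L[ℂ] ℂ, ∀ f, e f = S.ev f z := by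
  obtain ⟨C, hC, h⟩ := S.exists_norm_le
  have hpow : 0 < (1 - ‖z‖ ^ 2) ^ γ := Real.rpow_pos_of_pos (one_sub_norm_sq_pos hz) _
  refine ⟨((LinearMap.proj z).comp S.ev).mkContinuous (C / (1 - ‖z‖ ^ 2) ^ γ) fun f => ?_,
    fun f => rfl⟩
  rw [div_mul_eq_mul_div, le_div_iff₀ hpow]
  exact h f z hz

lemma exists_mul {ψ : ℂ → ℂ} {C : ℝ} (hψ : DifferentiableOn ℂ ψ disc)
    (hC : ∀ z ∈ disc, ‖ψ z‖ ≤ C) :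
    ∃ T : E →L[ℂ] E, ∀ f, ∀ z ∈ disc, S.ev (T f) z = ψ z * S.ev f z := by
  have hC0 : 0 ≤ C := (norm_nonneg _).trans (hC 0 (by simp))
  obtain ⟨T, hT, -⟩ := S.exists_clm IsDiscIsometry.id hψ hC0 (fun z hz =>
    mul_le_mul_of_nonneg_right (hC z hz) (Real.rpow_nonneg (one_sub_norm_sq_pos hz).le _))
  exact ⟨T, hT⟩

lemma exists_of_bounded {ψ : ℂ → ℂ} {C : ℝ} (hψ : DifferentiableOn ℂ ψ disc)
    (hC : ∀ z ∈ disc, ‖ψ z‖ ≤ C) : ∃ f, ∀ z ∈ disc, S.ev f z = ψ z := by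
  obtain ⟨T, hT⟩ := S.exists_mul hψ hC
  obtain ⟨g, hg⟩ := S.exists_one
  exact ⟨T g, fun z hz => by rw [hT g z hz, hg z hz, mul_one]⟩

lemma nontrivial : Nontrivial E := by
  obtain ⟨g, hg⟩ := S.exists_one
  refine ⟨g, 0, fun h => ?_⟩
  have := hg 0 (by simp)
  rw [h, map_zero] at this
  simp at this

end DiscSpace

/-! ### Weights and the growth function -/

/-- A holomorphic weight, bounded above and below, whose modulus has the limits `A` at `a` and `B`
at `b`. -/
structure IsWeight (ψ : ℂ → ℂ) (a b : ℂ) (A B : ℝ) : Prop where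
  differentiableOn : DifferentiableOn ℂ ψ disc
  lower : BoundedAwayFromZero ψ
  upper : ∃ C : ℝ, ∀ z ∈ disc, ‖ψ z‖ ≤ C
  tendsto_left : Tendsto (fun z => ‖ψ z‖) (𝓝[disc] a) (𝓝 A)
  tendsto_right : Tendsto (fun z => ‖ψ z‖) (𝓝[disc] b) (𝓝 B)

namespace IsWeight

variable {ψ : ℂ → ℂ} {u p a b : ℂ} {A B ρ : ℝ}

lemma swap (W : IsWeight ψ a b A B) : IsWeight ψ b a B A :=
  ⟨W.differentiableOn, W.lower, W.upper, W.tendsto_right, W.tendsto_left⟩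

lemma pos_left (W : IsWeight ψ a b A B) (ha : ‖a‖ = 1) : 0 < A := by
  have := neBot_nhdsWithin_disc ha
  obtain ⟨c, hc, h⟩ := W.lower
  refine hc.trans_le (ge_of_tendsto W.tendsto_left ?_)
  filter_upwards [self_mem_nhdsWithin] with z hz using h z hz

lemma ne_zero (W : IsWeight ψ a b A B) {z : ℂ} (hz : z ∈ disc) : ψ z ≠ 0 := by
  obtain ⟨c, hc, h⟩ := W.lower
  exact norm_pos_iff.1 (hc.trans_le (h z hz))

/-- This is the weight of the inverse operator, f ↦ (ψ ∘ φ⁻¹)⁻¹ · (f ∘ φ⁻¹). -/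
lemma symm (W : IsWeight ψ a b A B) (H : IsHypMob u p a b ρ) :
    IsWeight (fun z => (ψ (mob (conj u) (-(u * p)) z))⁻¹) b a B⁻¹ A⁻¹ where
  differentiableOn := by
    refine DifferentiableOn.inv (W.differentiableOn.comp
      H.symm.isDiscIsometry.differentiableOn H.symm.isDiscIsometry.bijOn.mapsTo)
      fun z hz => W.ne_zero (H.symm.map_mem hz)
  lower := by
    obtain ⟨C, hC⟩ := W.upper
    have h0 : 0 < C := (norm_pos_iff.2 (W.ne_zero (z := 0) (by simp))).trans_le (hC 0 (by simp))
    refine ⟨C⁻¹, inv_pos.2 h0, fun z hz => ?_⟩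
    rw [norm_inv]
    exact inv_anti₀ (norm_pos_iff.2 (W.ne_zero (H.symm.map_mem hz))) (hC _ (H.symm.map_mem hz))
  upper := by
    obtain ⟨c, hc, h⟩ := W.lower
    refine ⟨c⁻¹, fun z hz => ?_⟩
    rw [norm_inv]
    exact inv_anti₀ hc (h _ (H.symm.map_mem hz))
  tendsto_left := by
    simp only [norm_inv]
    exact (W.tendsto_right.comp H.symm.tendsto_left).inv₀ (W.swap.pos_left H.norm_b).ne'
  tendsto_right := by
    simp only [norm_inv]
    exact (W.tendsto_left.comp H.symm.tendsto_right).inv₀ (W.pos_left H.norm_a).ne'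

end IsWeight

/-- The function `|ψ| |φ'|^{-γ}` for the automorphism `φ = mob u p`. -/
def growth (p : ℂ) (γ : ℝ) (ψ : ℂ → ℂ) (z : ℂ) : ℝ :=
  ‖ψ z‖ * (‖1 - conj p * z‖ ^ 2 / (1 - ‖p‖ ^ 2)) ^ γ

section Growth

variable {ψ : ℂ → ℂ} {u p a b : ℂ} {A B ρ γ : ℝ}

lemma growth_nonneg (hp : ‖p‖ < 1) (z : ℂ) : 0 ≤ growth p γ ψ z := by
  have := one_sub_norm_sq_pos (mem_disc.2 hp)
  unfold growth
  positivity

lemma growth_mul (H : IsHypMob u p a b ρ) {z : ℂ} (hz : z ∈ disc) :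
    growth p γ ψ z * (1 - ‖mob u p z‖ ^ 2) ^ γ = ‖ψ z‖ * (1 - ‖z‖ ^ 2) ^ γ := by
  have h1 := one_sub_norm_sq_pos (mem_disc.2 H.norm_p)
  have h2 := one_sub_norm_sq_pos (H.map_mem hz)
  have h3 : ‖1 - conj p * z‖ ≠ 0 := norm_ne_zero_iff.2 (mob_den_ne H.norm_p (mem_disc.1 hz).le)
  rw [growth, mul_assoc, ← Real.mul_rpow (by positivity) h2.le,
    one_sub_norm_mob_sq H.norm_u H.norm_p (mem_disc.1 hz).le]
  congr 2
  field_simp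

/-- The factors 1 - |·|² telescope along the orbit. Hence a bound on the product of `growth` is
exactly the hypothesis of `exists_comp` for the n-th power of the operator. -/
lemma prod_growth_mul (H : IsHypMob u p a b ρ) {z : ℂ} (hz : z ∈ disc) (n : ℕ) :
    (∏ j ∈ Finset.range n, growth p γ ψ ((mob u p)^[j] z)) * (1 - ‖(mob u p)^[n] z‖ ^ 2) ^ γ
      = ‖∏ j ∈ Finset.range n, ψ ((mob u p)^[j] z)‖ * (1 - ‖z‖ ^ 2) ^ γ := by
  induction n with
  | zero => simp
  | succ n ih =>
    rw [Finset.prod_range_succ, Finset.prod_range_succ, Function.iterate_succ_apply', mul_assoc,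
      growth_mul H (H.iterate_mem hz n), norm_mul]
    linear_combination ‖ψ ((mob u p)^[n] z)‖ * ih

lemma exists_growth_le (H : IsHypMob u p a b ρ) (W : IsWeight ψ a b A B) (hγ : 0 ≤ γ) :
    ∃ K : ℝ, 0 < K ∧ ∀ z ∈ disc, growth p γ ψ z ≤ K := by
  obtain ⟨C, hC⟩ := W.upper
  have h0 : 0 < C := (norm_pos_iff.2 (W.ne_zero (z := 0) (by simp))).trans_le (hC 0 (by simp))
  have h1 := one_sub_norm_sq_pos (mem_disc.2 H.norm_p)
  refine ⟨C * (4 / (1 - ‖p‖ ^ 2)) ^ γ, by positivity, fun z hz => ?_⟩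
  unfold growth
  have h4 : ‖1 - conj p * z‖ ≤ 2 := by
    refine (norm_sub_le _ _).trans ?_
    rw [norm_mul, RCLike.norm_conj, norm_one]
    nlinarith [norm_nonneg p, norm_nonneg z, H.norm_p, mem_disc.1 hz]
  have h5 : ‖1 - conj p * z‖ ^ 2 ≤ 4 := by nlinarith [norm_nonneg (1 - conj p * z)]
  gcongr
  exact hC z hz

lemma tendsto_norm_den (p x : ℂ) :
    Tendsto (fun z => ‖1 - conj p * z‖) (𝓝[disc] x) (𝓝 ‖1 - conj p * x‖) := by
  refine ((Continuous.tendsto ?_ x).mono_left nhdsWithin_le_nhds)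
  fun_prop

lemma tendsto_growth_left (H : IsHypMob u p a b ρ) (W : IsWeight ψ a b A B) (hγ : 0 ≤ γ) :
    Tendsto (growth p γ ψ) (𝓝[disc] a) (𝓝 (A * ρ ^ γ)) := by
  rw [← H.norm_sq_div_left]
  exact W.tendsto_left.mul ((((tendsto_norm_den p a).pow 2).div_const _).rpow_const (Or.inr hγ))

lemma tendsto_growth_right (H : IsHypMob u p a b ρ) (W : IsWeight ψ a b A B) (hγ : 0 ≤ γ) :
    Tendsto (growth p γ ψ) (𝓝[disc] b) (𝓝 (B * ρ ^ (-γ))) := by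
  rw [Real.rpow_neg H.pos.le, ← Real.inv_rpow H.pos.le, ← H.norm_sq_div_right]
  exact W.tendsto_right.mul ((((tendsto_norm_den p b).pow 2).div_const _).rpow_const (Or.inr hγ))

end Growth

/-! ### Interpolating functions on the orbits -/

lemma norm_sin_le_exp (x : ℂ) : ‖Complex.sin x‖ ≤ Real.exp |x.im| := by
  rw [Complex.sin, norm_div, norm_mul, Complex.norm_I, mul_one]
  have h1 : ‖Complex.exp (-x * Complex.I)‖ ≤ Real.exp |x.im| := by
    rw [Complex.norm_exp]
    simpa using le_abs_self x.im
  have h2 : ‖Complex.exp (x * Complex.I)‖ ≤ Real.exp |x.im| := by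
    rw [Complex.norm_exp]
    simpa using neg_le_abs x.im
  have := norm_sub_le (Complex.exp (-x * Complex.I)) (Complex.exp (x * Complex.I))
  simp only [Complex.norm_ofNat]
  linarith

lemma differentiable_dslope_sin : Differentiable ℂ (dslope Complex.sin 0) := by
  rw [← differentiableOn_univ, Complex.differentiableOn_dslope univ_mem]
  exact Complex.differentiable_sin.differentiableOn

/-- `dslope Complex.sin 0` is sin x / x with value 1 at 0. It is bounded by compactness for |x| ≤ 1,
and by e^t on the rest of the strip. -/
lemma exists_norm_dslope_sin_le (t : ℝ) :
    ∃ C : ℝ, ∀ x : ℂ, |x.im| ≤ t → ‖dslope Complex.sin 0 x‖ ≤ C := by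
  obtain ⟨C, hC⟩ := (isCompact_closedBall (0 : ℂ) 1).exists_bound_of_continuousOn
    differentiable_dslope_sin.continuous.continuousOn
  refine ⟨max C (Real.exp t), fun x hx => ?_⟩
  by_cases h : ‖x‖ ≤ 1
  · exact (hC x (by simpa using h)).trans (le_max_left _ _)
  · push Not at h
    have hx0 : x ≠ 0 := by rintro rfl; simp at h; linarith
    refine le_trans ?_ (le_max_right _ _)
    rw [dslope_of_ne _ hx0, slope_def_field]
    simp only [Complex.sin_zero, sub_zero, norm_div]
    rw [div_le_iff₀ (by linarith)]
    have h1 := (norm_sin_le_exp x).trans (Real.exp_le_exp.2 hx)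
    nlinarith [Real.exp_pos t]

section HalfPlane

variable {a b : ℂ}

lemma differentiableOn_log_halfPlaneCoord (ha : ‖a‖ = 1) (hb : ‖b‖ = 1) (hab : a ≠ b) :
    DifferentiableOn ℂ (fun z => Complex.log (halfPlaneCoord a b z)) disc := by
  have h : DifferentiableOn ℂ (halfPlaneCoord a b) disc := by
    unfold halfPlaneCoord
    refine DifferentiableOn.div (by fun_prop) (by fun_prop)
      fun z hz => sub_ne_zero.2 (ne_of_mem_disc ha hz)
  exact h.clog fun z hz => Or.inl (halfPlaneCoord_re_pos ha hb hab hz)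

lemma abs_im_log_halfPlaneCoord_le (a b z : ℂ) :
    |(Complex.log (halfPlaneCoord a b z)).im| ≤ Real.pi := by
  rw [Complex.log_im]
  exact Complex.abs_arg_le_pi _

/-- Take s = sin x / x with x = (π/log ρ)(log w(z) - log w(z₀)): at the n-th orbit point x = nπ. The
imaginary part of log w is bounded, so x stays in a strip, where sin x / x is bounded. -/
lemma exists_orbit_interpolation {ρ : ℝ} (hρ : 1 < ρ) (ha : ‖a‖ = 1) (hb : ‖b‖ = 1) (hab : a ≠ b)
    {z₀ : ℂ} (hz₀ : z₀ ∈ disc) :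
    ∃ s : ℂ → ℂ, DifferentiableOn ℂ s disc ∧ (∃ C : ℝ, ∀ z ∈ disc, ‖s z‖ ≤ C) ∧ s z₀ = 1 ∧
      ∀ z : ℂ, ∀ n : ℤ, n ≠ 0 →
        halfPlaneCoord a b z = (ρ : ℂ) ^ n * halfPlaneCoord a b z₀ → s z = 0 := by
  have hτ : 0 < Real.log ρ := Real.log_pos hρ
  have hw0 : halfPlaneCoord a b z₀ ≠ 0 := by
    intro h
    have := halfPlaneCoord_re_pos ha hb hab hz₀
    rw [h] at this
    simp at this
  set k : ℝ := Real.pi / Real.log ρ with hk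
  set x : ℂ → ℂ := fun z =>
    k * (Complex.log (halfPlaneCoord a b z) - Complex.log (halfPlaneCoord a b z₀)) with hx
  have hxd : DifferentiableOn ℂ x disc :=
    ((differentiableOn_log_halfPlaneCoord ha hb hab).sub_const _).const_mul _
  refine ⟨fun z => dslope Complex.sin 0 (x z),
    differentiable_dslope_sin.comp_differentiableOn hxd, ?_, ?_, ?_⟩
  · obtain ⟨C, hC⟩ := exists_norm_dslope_sin_le (|k| * (Real.pi + Real.pi))
    refine ⟨C, fun z _ => hC _ ?_⟩
    simp only [hx]
    rw [Complex.im_ofReal_mul, abs_mul, Complex.sub_im]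
    gcongr
    exact (abs_sub _ _).trans (add_le_add (abs_im_log_halfPlaneCoord_le _ _ _)
      (abs_im_log_halfPlaneCoord_le _ _ _))
  · simp [hx]
  · intro z n hn hz
    have hval : x z = n * Real.pi := by
      simp only [hx]
      have h1 : ((ρ : ℂ) ^ n) = ((ρ ^ n : ℝ) : ℂ) := by push_cast; rfl
      rw [hz, h1, Complex.log_ofReal_mul (by positivity) hw0, Real.log_zpow, hk]
      have : (Real.log ρ : ℂ) ≠ 0 := by exact_mod_cast hτ.ne'
      push_cast
      rw [add_sub_cancel_right]
      have e : Complex.log ↑ρ = (Real.log ρ : ℂ) := (Complex.ofReal_log (by linarith)).symm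
      field_simp
    have hne : x z ≠ 0 := by
      rw [hval]
      exact mul_ne_zero (by exact_mod_cast hn) (by exact_mod_cast Real.pi_ne_zero)
    simp only
    rw [dslope_of_ne _ hne, slope_def_field, hval, Complex.sin_int_mul_pi]
    simp

end HalfPlane

/-! ### Powers of a weighted composition operator -/

section Powers

variable {E : Type*} [NormedAddCommGroup E] [NormedSpace ℂ E] {γ : ℝ} (S : DiscSpace E γ)
  {ψ : ℂ → ℂ} {u p a b : ℂ} {A B ρ : ℝ} {T : E →L[ℂ] E}

/-- `T` is the weighted composition operator `f ↦ ψ · (f ∘ φ)`. -/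
def DiscSpace.IsWeightedComp (φ ψ : ℂ → ℂ) (T : E →L[ℂ] E) : Prop :=
  ∀ f, ∀ z ∈ disc, S.ev (T f) z = ψ z * S.ev f (φ z)

lemma exists_isWeightedComp (H : IsHypMob u p a b ρ) (W : IsWeight ψ a b A B) :
    ∃ T : E →L[ℂ] E, S.IsWeightedComp (mob u p) ψ T := by
  obtain ⟨K, hK, h⟩ := exists_growth_le H W S.pos.le
  obtain ⟨T, hT, -⟩ := S.exists_clm H.isDiscIsometry W.differentiableOn hK.le (fun z hz => by
    rw [← growth_mul H hz]
    exact mul_le_mul_of_nonneg_right (h z hz)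
      (Real.rpow_nonneg (one_sub_norm_sq_pos (H.map_mem hz)).le _))
  exact ⟨T, hT⟩

variable {S}

lemma DiscSpace.IsWeightedComp.pow_apply (hT : S.IsWeightedComp (mob u p) ψ T)
    (H : IsHypMob u p a b ρ) (n : ℕ) (f : E) {z : ℂ} (hz : z ∈ disc) :
    S.ev ((T ^ n) f) z
      = (∏ j ∈ Finset.range n, ψ ((mob u p)^[j] z)) * S.ev f ((mob u p)^[n] z) := by
  induction n generalizing f with
  | zero => simp
  | succ n ih =>
    rw [pow_succ, mul_apply_eq_comp, ih, hT f _ (H.iterate_mem hz n), Finset.prod_range_succ,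
      Function.iterate_succ_apply']
    ring

lemma differentiableOn_prod_iterate (H : IsHypMob u p a b ρ) (W : IsWeight ψ a b A B) (n : ℕ) :
    DifferentiableOn ℂ (fun z => ∏ j ∈ Finset.range n, ψ ((mob u p)^[j] z)) disc := by
  refine DifferentiableOn.fun_finsetProd fun j _ => ?_
  exact W.differentiableOn.comp (H.isDiscIsometry.iterate j).differentiableOn
    (H.isDiscIsometry.iterate j).bijOn.mapsTo

/-- Tⁿ is again a weighted composition operator, with symbol φⁿ and weight the orbit product of ψ,
so the norm axiom applies to it directly, with the constant from `prod_le`. -/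
lemma DiscSpace.IsWeightedComp.exists_norm_pow_le (hT : S.IsWeightedComp (mob u p) ψ T)
    (H : IsHypMob u p a b ρ) (W : IsWeight ψ a b A B) {R : ℝ}
    (hA : A * ρ ^ γ < R) (hB : B * ρ ^ (-γ) < R) :
    ∃ C : ℝ, ∀ n : ℕ, ‖T ^ n‖ ≤ C * R ^ n := by
  have hR : 0 < R := by
    have := W.pos_left H.norm_a
    have := Real.rpow_pos_of_pos H.pos γ
    exact lt_trans (by positivity) hA
  obtain ⟨K, -, hK⟩ := exists_growth_le H W S.pos.le
  obtain ⟨C, hC, h⟩ := H.prod_le (Q := growth p γ ψ) hR (fun z _ => growth_nonneg H.norm_p z) hK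
    (((tendsto_growth_left H W S.pos.le).eventually_lt_const hA).mono fun _ h => h.le)
    (((tendsto_growth_right H W S.pos.le).eventually_lt_const hB).mono fun _ h => h.le)
  refine ⟨C, fun n => ?_⟩
  obtain ⟨T', hT', hn⟩ := S.exists_clm (H.isDiscIsometry.iterate n)
    (differentiableOn_prod_iterate H W n) (M := C * R ^ n) (by positivity) (fun z hz => by
      rw [← prod_growth_mul H hz n]
      exact mul_le_mul_of_nonneg_right (h n z hz)
        (Real.rpow_nonneg (one_sub_norm_sq_pos (H.iterate_mem hz n)).le _))
  have : T ^ n = T' := by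
    ext f
    exact S.ext fun z hz => by rw [hT' f z hz, hT.pow_apply H n f hz]
  rwa [this]

/-- Writing the decay towards a as an orbit product lets it be merged with the product of `growth`.
-/
lemma norm_iterate_sub_pow (H : IsHypMob u p a b ρ) {z : ℂ} (hz : z ∈ disc) (k n : ℕ) :
    ‖(mob u p)^[n] z - a‖ ^ k = ‖z - a‖ ^ k *
      ∏ j ∈ Finset.range n, (‖1 - conj p * b‖ / ‖1 - conj p * (mob u p)^[j] z‖) ^ k := by
  induction n with
  | zero => simp
  | succ n ih =>
    have hn := H.iterate_mem hz n
    have h1 := mob_sub_left_mul H.norm_p H.norm_a H.norm_b H.ne H.map_a H.map_b (mem_disc.1 hn).le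
    have h2 : ‖1 - conj p * (mob u p)^[n] z‖ ≠ 0 :=
      norm_ne_zero_iff.2 (mob_den_ne H.norm_p (mem_disc.1 hn).le)
    rw [Finset.prod_range_succ, ← mul_assoc, ← ih, ← mul_pow, Function.iterate_succ_apply']
    congr 1
    rw [mul_div_assoc', eq_div_iff h2, ← norm_mul, ← norm_mul, h1]

/-- A zero of order k at a contributes a factor per step that tends to ρ^{-k} at a and to 1 at b.
Only the radius at a is lowered, as far as desired. -/
lemma DiscSpace.IsWeightedComp.exists_norm_pow_apply_le (hT : S.IsWeightedComp (mob u p) ψ T)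
    (H : IsHypMob u p a b ρ) (W : IsWeight ψ a b A B) {R : ℝ} {k : ℕ}
    (hA : A * ρ ^ γ / ρ ^ k < R) (hB : B * ρ ^ (-γ) < R) {h : E} {D : ℝ}
    (hh : ∀ z ∈ disc, ‖S.ev h z‖ ≤ D * ‖z - a‖ ^ k) :
    ∃ C : ℝ, ∀ n : ℕ, ‖(T ^ n) h‖ ≤ C * R ^ n := by
  have hρ := H.pos
  have hR : 0 < R := by
    have := W.pos_left H.norm_a
    have := Real.rpow_pos_of_pos H.pos γ
    exact lt_trans (by positivity) hA
  have hD : 0 ≤ D := by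
    have h1 := (norm_nonneg _).trans (hh 0 (by simp))
    simpa [H.norm_a] using h1
  have hb0 : 0 < ‖1 - conj p * b‖ := norm_pos_iff.2 (mob_den_ne H.norm_p H.norm_b.le)
  have ha0 : 0 < ‖1 - conj p * a‖ := norm_pos_iff.2 (mob_den_ne H.norm_p H.norm_a.le)
  set Q : ℂ → ℝ := fun z => growth p γ ψ z * (‖1 - conj p * b‖ / ‖1 - conj p * z‖) ^ k with hQ
  obtain ⟨K, hK0, hK⟩ := exists_growth_le H W S.pos.le
  have hp1 : 0 < 1 - ‖p‖ := by linarith [H.norm_p]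
  have hden : ∀ z ∈ disc, 1 - ‖p‖ ≤ ‖1 - conj p * z‖ := by
    intro z hz
    have h1 := norm_sub_norm_le 1 (conj p * z)
    rw [norm_mul, RCLike.norm_conj, norm_one] at h1
    nlinarith [norm_nonneg p, mem_disc.1 hz]
  have hQ0 : ∀ z ∈ disc, 0 ≤ Q z := fun z _ =>
    mul_nonneg (growth_nonneg H.norm_p z) (by positivity)
  have hQK : ∀ z ∈ disc, Q z ≤ K * (‖1 - conj p * b‖ / (1 - ‖p‖)) ^ k := by
    intro z hz
    simp only [hQ]
    have := growth_nonneg (γ := γ) (ψ := ψ) H.norm_p z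
    gcongr
    · exact hK z hz
    · exact hden z hz
  have hratio : ‖1 - conj p * b‖ / ‖1 - conj p * a‖ = ρ⁻¹ := by
    rw [H.eq_mul, norm_mul, Complex.norm_real, Real.norm_of_nonneg hρ.le]
    field_simp
  have hQa : Tendsto Q (𝓝[disc] a) (𝓝 (A * ρ ^ γ / ρ ^ k)) := by
    have h1 := (tendsto_growth_left H W S.pos.le).mul
      (((tendsto_const_nhds (x := ‖1 - conj p * b‖)).div (tendsto_norm_den p a) ha0.ne').pow k)
    rwa [hratio, inv_pow, ← div_eq_mul_inv] at h1
  have hQb : Tendsto Q (𝓝[disc] b) (𝓝 (B * ρ ^ (-γ))) := by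
    have h1 := (tendsto_growth_right H W S.pos.le).mul
      (((tendsto_const_nhds (x := ‖1 - conj p * b‖)).div (tendsto_norm_den p b) hb0.ne').pow k)
    rwa [div_self hb0.ne', one_pow, mul_one] at h1
  obtain ⟨C, hC, hprod⟩ := H.prod_le hR hQ0 hQK
    ((hQa.eventually_lt_const hA).mono fun _ h => h.le)
    ((hQb.eventually_lt_const hB).mono fun _ h => h.le)
  obtain ⟨g, hg⟩ := S.exists_one
  refine ⟨D * 2 ^ k * C * ‖g‖, fun n => ?_⟩
  have hdiff : DifferentiableOn ℂ (fun z => (∏ j ∈ Finset.range n, ψ ((mob u p)^[j] z)) *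
      S.ev h ((mob u p)^[n] z)) disc :=
    (differentiableOn_prod_iterate H W n).mul ((S.ev_mem h).1.comp
      (H.isDiscIsometry.iterate n).differentiableOn (H.isDiscIsometry.iterate n).bijOn.mapsTo)
  -- Tⁿh is viewed as a weighted composition operator applied to the constant 1, with h ∘ φⁿ
  -- absorbed into the weight.
  obtain ⟨x, hx, hxn⟩ := S.exists_comp _ _ (D * 2 ^ k * C * R ^ n) (H.isDiscIsometry.iterate n)
    hdiff (by positivity) (fun z hz => by
      have hnz := H.iterate_mem hz n
      have hpos := Real.rpow_nonneg (one_sub_norm_sq_pos hnz).le γ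
      have hz2 : ‖z - a‖ ≤ 2 := by
        have := norm_sub_le z a
        rw [H.norm_a] at this
        linarith [mem_disc.1 hz]
      have hP : 0 ≤ ∏ j ∈ Finset.range n, growth p γ ψ ((mob u p)^[j] z) :=
        Finset.prod_nonneg fun j _ => growth_nonneg H.norm_p _
      rw [norm_mul, mul_right_comm, ← prod_growth_mul H hz n, mul_right_comm]
      refine mul_le_mul_of_nonneg_right ?_ hpos
      calc _ ≤ (∏ j ∈ Finset.range n, growth p γ ψ ((mob u p)^[j] z)) *
            (D * ‖(mob u p)^[n] z - a‖ ^ k) := by gcongr; exact hh _ hnz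
        _ = D * ‖z - a‖ ^ k * ∏ j ∈ Finset.range n, Q ((mob u p)^[j] z) := by
            rw [norm_iterate_sub_pow H hz]
            simp only [hQ, Finset.prod_mul_distrib]
            ring
        _ ≤ D * 2 ^ k * (C * R ^ n) := by
            have := hprod n z hz
            have h0 : 0 ≤ ∏ j ∈ Finset.range n, Q ((mob u p)^[j] z) :=
              Finset.prod_nonneg fun j _ => hQ0 _ (H.iterate_mem hz j)
            gcongr
        _ = _ := by ring) g
  have : (T ^ n) h = x := S.ext fun z hz => by
    rw [hx z hz, hT.pow_apply H n h hz, hg _ (H.iterate_mem hz n), mul_one]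
  rw [this]
  linarith

lemma IsHypMob.tendsto_iterate (H : IsHypMob u p a b ρ) {z : ℂ} (hz : z ∈ disc) :
    Tendsto (fun n : ℕ => (mob u p)^[n] z) atTop (𝓝[disc] a) := by
  refine tendsto_nhdsWithin_iff.2 ⟨?_, Eventually.of_forall fun n => H.iterate_mem hz n⟩
  have hw := H.halfPlaneCoord_norm_pos hz
  rw [tendsto_iff_norm_sub_tendsto_zero]
  have h1 : Tendsto (fun n : ℕ => ‖a * conj b - 1‖ * 2 / ‖halfPlaneCoord a b z‖ * (ρ⁻¹) ^ n)
      atTop (𝓝 0) := by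
    simpa using (tendsto_pow_atTop_nhds_zero_of_lt_one (inv_nonneg.2 H.pos.le)
      (inv_lt_one_of_one_lt₀ H.one_lt)).const_mul (‖a * conj b - 1‖ * 2 / ‖halfPlaneCoord a b z‖)
  refine squeeze_zero (fun n => norm_nonneg _) (fun n => ?_) h1
  have hn := H.iterate_mem hz n
  have hρ := H.pos
  have h2 := congrArg norm (H.halfPlaneCoord_iterate hz n)
  have h3 : 0 < ‖(mob u p)^[n] z - a‖ :=
    norm_pos_iff.2 (sub_ne_zero.2 (ne_of_mem_disc H.norm_a hn))
  have h4 : ‖(mob u p)^[n] z - b‖ ≤ 2 := by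
    have := norm_sub_le ((mob u p)^[n] z) b
    rw [H.norm_b] at this
    linarith [mem_disc.1 hn]
  rw [halfPlaneCoord, norm_div, norm_mul, norm_mul, norm_pow, Complex.norm_real,
    Real.norm_of_nonneg hρ.le, div_eq_iff h3.ne'] at h2
  rw [inv_pow, ← div_eq_mul_inv, div_div, le_div_iff₀ (by positivity)]
  calc _ = ρ ^ n * ‖halfPlaneCoord a b z‖ * ‖(mob u p)^[n] z - a‖ := by ring
    _ = _ := h2.symm
    _ ≤ _ := by gcongr

/-- The bound on point evaluations and `prod_growth_mul` dominate the terms by a multiple of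
|l|^{-n} times the product of `growth` along one orbit. That orbit tends to a, so the ratio test
sees only the limit at a. -/
lemma DiscSpace.IsWeightedComp.summable_eval (hT : S.IsWeightedComp (mob u p) ψ T)
    (H : IsHypMob u p a b ρ) (W : IsWeight ψ a b A B) {l : ℂ} (hl : A * ρ ^ γ < ‖l‖)
    {z : ℂ} (hz : z ∈ disc) (f : E) :
    Summable fun n : ℕ => (l⁻¹) ^ n * S.ev ((T ^ n) f) z := by
  have hρ := H.pos
  have hA := W.pos_left H.norm_a
  have hl0 : 0 < ‖l‖ := lt_trans (by positivity) hl
  obtain ⟨C, hC, hCf⟩ := S.exists_norm_le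
  have hz2 := Real.rpow_pos_of_pos (one_sub_norm_sq_pos hz) γ
  set t : ℕ → ℝ := fun n =>
    (‖l‖⁻¹) ^ n * ∏ j ∈ Finset.range n, growth p γ ψ ((mob u p)^[j] z) with ht
  have hgpos : ∀ n : ℕ, 0 < growth p γ ψ ((mob u p)^[n] z) := by
    intro n
    have hn := H.iterate_mem hz n
    have h1 := one_sub_norm_sq_pos (mem_disc.2 H.norm_p)
    have h2 := norm_pos_iff.2 (W.ne_zero hn)
    have h3 := norm_pos_iff.2 (mob_den_ne H.norm_p (mem_disc.1 hn).le)
    unfold growth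
    positivity
  have htpos : ∀ n, 0 < t n := fun n =>
    mul_pos (by positivity) (Finset.prod_pos fun j _ => hgpos j)
  have htsum : Summable t := by
    refine summable_of_ratio_test_tendsto_lt_one (l := A * ρ ^ γ * ‖l‖⁻¹) ?_
      (Eventually.of_forall fun n => (htpos n).ne') ?_
    · rw [← div_eq_mul_inv, div_lt_one hl0]; exact hl
    · have h1 := ((tendsto_growth_left H W S.pos.le).comp (H.tendsto_iterate hz)).mul_const ‖l‖⁻¹
      refine h1.congr fun n => ?_
      rw [Real.norm_of_nonneg (htpos _).le, Real.norm_of_nonneg (htpos _).le,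
        eq_div_iff (htpos n).ne']
      simp only [ht, Function.comp_apply, Finset.prod_range_succ, pow_succ]
      ring
  refine Summable.of_norm_bounded (htsum.mul_left (C * ‖f‖ / (1 - ‖z‖ ^ 2) ^ γ)) fun n => ?_
  have hn := H.iterate_mem hz n
  have hn2 := Real.rpow_pos_of_pos (one_sub_norm_sq_pos hn) γ
  rw [norm_mul, norm_pow, norm_inv, hT.pow_apply H n f hz, norm_mul]
  have h1 := prod_growth_mul (γ := γ) (ψ := ψ) H hz n
  have h2 := hCf f _ hn
  have h3 : ‖∏ j ∈ Finset.range n, ψ ((mob u p)^[j] z)‖ = (1 / (1 - ‖z‖ ^ 2) ^ γ) *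
      ((∏ j ∈ Finset.range n, growth p γ ψ ((mob u p)^[j] z)) *
        (1 - ‖(mob u p)^[n] z‖ ^ 2) ^ γ) := by
    rw [h1]; field_simp
  have hP : 0 ≤ ∏ j ∈ Finset.range n, growth p γ ψ ((mob u p)^[j] z) :=
    Finset.prod_nonneg fun j _ => (hgpos j).le
  rw [h3]
  simp only [ht]
  calc _ = (‖l‖⁻¹) ^ n * (1 / (1 - ‖z‖ ^ 2) ^ γ) *
        (∏ j ∈ Finset.range n, growth p γ ψ ((mob u p)^[j] z)) *
        (‖S.ev f ((mob u p)^[n] z)‖ * (1 - ‖(mob u p)^[n] z‖ ^ 2) ^ γ) := by ring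
    _ ≤ (‖l‖⁻¹) ^ n * (1 / (1 - ‖z‖ ^ 2) ^ γ) *
        (∏ j ∈ Finset.range n, growth p γ ψ ((mob u p)^[j] z)) * (C * ‖f‖) := by gcongr
    _ = _ := by ring

end Powers

/-! ### The spectrum -/

section Spectrum

variable {E : Type*} [NormedAddCommGroup E] [NormedSpace ℂ E] {γ : ℝ} {S : DiscSpace E γ}
  {ψ : ℂ → ℂ} {u p a b : ℂ} {A B ρ : ℝ}

lemma IsHypMob.halfPlaneCoord_inv_iterate (H : IsHypMob u p a b ρ) {z : ℂ} (hz : z ∈ disc)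
    (n : ℕ) : halfPlaneCoord a b ((mob (conj u) (-(u * p)))^[n] z)
      = ((ρ : ℂ) ^ n)⁻¹ * halfPlaneCoord a b z := by
  have hρ : (ρ : ℂ) ≠ 0 := by exact_mod_cast H.pos.ne'
  induction n with
  | zero => simp
  | succ n ih =>
    have hn := H.symm.iterate_mem hz n
    have h1 := H.halfPlaneCoord_map (H.symm.map_mem hn)
    rw [mob_inv_mob H.norm_u H.norm_p (mem_disc.1 hn).le, ih] at h1
    rw [Function.iterate_succ_apply', pow_succ, mul_inv]
    refine mul_left_cancel₀ hρ ?_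
    rw [← h1]
    field_simp

lemma isWeightedComp_mul_inv (H : IsHypMob u p a b ρ) (W : IsWeight ψ a b A B) {T T' : E →L[ℂ] E}
    (hT : S.IsWeightedComp (mob u p) ψ T)
    (hT' : S.IsWeightedComp (mob (conj u) (-(u * p)))
      (fun z => (ψ (mob (conj u) (-(u * p)) z))⁻¹) T') : T * T' = 1 ∧ T' * T = 1 := by
  constructor <;> ext f <;> refine S.ext fun z hz => ?_
  · rw [mul_apply_eq_comp, one_apply_eq_self, hT _ z hz, hT' _ _ (H.map_mem hz),
      mob_mob_inv H.norm_u H.norm_p (mem_disc.1 hz).le]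
    simp only [mob_mob_inv H.norm_u H.norm_p (mem_disc.1 hz).le]
    rw [mul_inv_cancel_left₀ (W.ne_zero hz)]
  · rw [mul_apply_eq_comp, one_apply_eq_self, hT' _ z hz, hT _ _ (H.symm.map_mem hz),
      mob_inv_mob H.norm_u H.norm_p (mem_disc.1 hz).le,
      inv_mul_cancel_left₀ (W.ne_zero (H.symm.map_mem hz))]

/-- With s = t/log ρ, the function w^{is} is bounded with bounded inverse, and composition with φ
multiplies it by e^{it}. Conjugating T by this multiplier therefore gives e^{it}T. -/
lemma DiscSpace.IsWeightedComp.exp_mul_mem_spectrum {T : E →L[ℂ] E} (H : IsHypMob u p a b ρ)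
    (hT : S.IsWeightedComp (mob u p) ψ T) {l : ℂ} (hl : l ∈ spectrum ℂ T) (t : ℝ) :
    Complex.exp (t * Complex.I) * l ∈ spectrum ℂ T := by
  have hτ : 0 < Real.log ρ := Real.log_pos H.one_lt
  set h : ℝ → ℂ → ℂ := fun s z =>
    Complex.exp (s * Complex.I * Complex.log (halfPlaneCoord a b z)) with hh
  have hd : ∀ s, DifferentiableOn ℂ (h s) disc := fun s =>
    ((differentiableOn_log_halfPlaneCoord H.norm_a H.norm_b H.ne).const_mul _).cexp
  have hbd : ∀ s, ∀ z ∈ disc, ‖h s z‖ ≤ Real.exp (|s| * Real.pi) := by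
    intro s z _
    rw [hh, Complex.norm_exp, Real.exp_le_exp, mul_assoc, Complex.re_ofReal_mul, Complex.I_mul_re]
    calc _ ≤ |s * -(Complex.log (halfPlaneCoord a b z)).im| := le_abs_self _
      _ ≤ _ := by
        rw [abs_mul, abs_neg]
        gcongr
        exact abs_im_log_halfPlaneCoord_le _ _ _
  set s : ℝ := t / Real.log ρ with hs
  obtain ⟨M, hM⟩ := S.exists_mul (hd s) (hbd s)
  obtain ⟨N, hN⟩ := S.exists_mul (hd (-s)) (hbd (-s))
  have hprod : ∀ z, h s z * h (-s) z = 1 := by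
    intro z
    simp only [hh]
    rw [← Complex.exp_add]
    convert Complex.exp_zero using 2
    push_cast
    ring
  have hcomp : ∀ z ∈ disc, h s (mob u p z) = Complex.exp (t * Complex.I) * h s z := by
    intro z hz
    have hw0 : halfPlaneCoord a b z ≠ 0 := norm_pos_iff.1 (H.halfPlaneCoord_norm_pos hz)
    simp only [hh]
    rw [H.halfPlaneCoord_map hz, Complex.log_ofReal_mul H.pos hw0, ← Complex.exp_add]
    congr 1
    have hτ' : (Real.log ρ : ℂ) ≠ 0 := by exact_mod_cast hτ.ne'
    rw [hs]
    push_cast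
    field_simp
  have hMN : M * N = 1 := by
    ext f
    refine S.ext fun z hz => ?_
    rw [mul_apply_eq_comp, one_apply_eq_self, hM _ z hz, hN _ z hz, ← mul_assoc, hprod, one_mul]
  have hNM : N * M = 1 := by
    ext f
    refine S.ext fun z hz => ?_
    rw [mul_apply_eq_comp, one_apply_eq_self, hN _ z hz, hM _ z hz, ← mul_assoc,
      mul_comm (h (-s) z), hprod, one_mul]
  set V : (E →L[ℂ] E)ˣ := ⟨M, N, hMN, hNM⟩ with hV
  set r : ℂˣ := Units.mk0 (Complex.exp (t * Complex.I)) (Complex.exp_ne_zero _) with hr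
  have hconj : N * T * M = r • T := by
    ext f
    refine S.ext fun z hz => ?_
    rw [Units.smul_def, smul_apply, map_smul, Pi.smul_apply,
      mul_apply_eq_comp, mul_apply_eq_comp, hN _ z hz, hT _ z hz, hM _ _ (H.map_mem hz),
      hcomp z hz, hT _ z hz, smul_eq_mul, hr, Units.val_mk0]
    linear_combination (ψ z * Complex.exp (t * Complex.I) * S.ev f (mob u p z)) * hprod z
  have h1 : spectrum ℂ (r • T) = spectrum ℂ T := by
    rw [← hconj]
    exact spectrum.units_conjugate' (u := V)
  rw [← h1]
  exact spectrum.smul_mem_smul_iff.2 hl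

lemma mul_rpow_neg_inv (hρ : 0 < ρ) (B γ : ℝ) : B⁻¹ * ρ ^ γ = (B * ρ ^ (-γ))⁻¹ := by
  rw [mul_inv, Real.rpow_neg hρ.le, inv_inv]

lemma mul_rpow_inv (hρ : 0 < ρ) (A γ : ℝ) : A⁻¹ * ρ ^ (-γ) = (A * ρ ^ γ)⁻¹ := by
  rw [mul_inv, Real.rpow_neg hρ.le]

variable (S)

/-- The spectrum of a weighted composition operator whose symbol is a hyperbolic automorphism. -/
theorem exists_spectrum_eq_annulus [CompleteSpace E] (H : IsHypMob u p a b ρ)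
    (W : IsWeight ψ a b A B) :
    ∃ T : E →L[ℂ] E, S.IsWeightedComp (mob u p) ψ T ∧
      spectrum ℂ T = annulus (A * ρ ^ γ) (B * ρ ^ (-γ)) := by
  obtain ⟨T, hT⟩ := exists_isWeightedComp S H W
  have H' := H.symm
  have W' := W.symm H
  obtain ⟨T', hT'⟩ := exists_isWeightedComp S H' W'
  obtain ⟨hTT', hT'T⟩ := isWeightedComp_mul_inv H W hT hT'
  refine ⟨T, hT, ?_⟩
  have := S.nontrivial
  have hρ := H.pos
  have hA := W.pos_left H.norm_a
  have hB := W.swap.pos_left H.norm_b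
  set Ra := A * ρ ^ γ with hRa
  set Rb := B * ρ ^ (-γ) with hRb
  have hRa0 : 0 < Ra := by positivity
  have hRb0 : 0 < Rb := by positivity
  have eB : B⁻¹ * ρ ^ γ = Rb⁻¹ := mul_rpow_neg_inv hρ B γ
  have eA : A⁻¹ * ρ ^ (-γ) = Ra⁻¹ := mul_rpow_inv hρ A γ
  set U : (E →L[ℂ] E)ˣ := ⟨T, T', hTT', hT'T⟩ with hU
  have hUn : ∀ n : ℕ, (U ^ (n : ℤ) : (E →L[ℂ] E)ˣ).val = T ^ n := fun n => by
    rw [zpow_natCast, Units.val_pow_eq_pow_val]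
  have hUn' : ∀ n : ℕ, (U ^ (-(n : ℤ)) : (E →L[ℂ] E)ˣ).val = T' ^ n := fun n => by
    rw [zpow_neg, zpow_natCast, ← inv_pow, Units.val_pow_eq_pow_val]; rfl
  have hupper : ∀ l ∈ spectrum ℂ T, ‖l‖ ≤ max Ra Rb := by
    intro l hl
    refine le_of_forall_gt_imp_ge_of_dense fun R hR => ?_
    obtain ⟨C, hC⟩ := hT.exists_norm_pow_le H W ((le_max_left _ _).trans_lt hR)
      ((le_max_right _ _).trans_lt hR)
    exact norm_le_of_norm_pow_le (lt_trans (lt_max_of_lt_left hRa0) hR) hC hl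
  -- The upper bound for the inverse operator, whose radii are Rb⁻¹ at its attracting point b and
  -- Ra⁻¹ at a.
  have hlower : ∀ l ∈ spectrum ℂ T, min Ra Rb ≤ ‖l‖ := by
    intro l hl
    have hl0 : l ≠ 0 := spectrum.ne_zero_of_mem_of_unit (a := U) hl
    have hmin : 0 < min Ra Rb := lt_min hRa0 hRb0
    have hl' : l⁻¹ ∈ spectrum ℂ T' :=
      (spectrum.inv_mem_iff (r := Units.mk0 l hl0) (a := U)).1 hl
    rw [← inv_le_inv₀ (norm_pos_iff.2 hl0) hmin, ← norm_inv]
    refine le_of_forall_gt_imp_ge_of_dense fun R hR => ?_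
    obtain ⟨C, hC⟩ := hT'.exists_norm_pow_le H' W' (R := R)
      (by rw [eB]; exact (inv_anti₀ hmin (min_le_right _ _)).trans_lt hR)
      (by rw [eA]; exact (inv_anti₀ hmin (min_le_left _ _)).trans_lt hR)
    exact norm_le_of_norm_pow_le (lt_trans (inv_pos.2 hmin) hR) hC hl'
  have h0d : (0 : ℂ) ∈ disc := by simp
  obtain ⟨e, he⟩ := S.exists_evCLM h0d
  obtain ⟨s, hsd, ⟨Cs, hCs⟩, hs0, hsn⟩ :=
    exists_orbit_interpolation H.one_lt H.norm_a H.norm_b H.ne h0d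
  have hvanish : ∀ h : E, (∀ z ∈ disc, s z = 0 → S.ev h z = 0) →
      ∀ n : ℤ, n ≠ 0 → e ((U ^ n : (E →L[ℂ] E)ˣ).val h) = 0 := by
    intro h hh n hn
    rw [he]
    obtain ⟨m, rfl | rfl⟩ := n.eq_nat_or_neg
    · rw [hUn, hT.pow_apply H m h h0d, hh _ (H.iterate_mem h0d m), mul_zero]
      refine hsn _ m hn ?_
      rw [H.halfPlaneCoord_iterate h0d, zpow_natCast]
    · rw [hUn', hT'.pow_apply H' m h h0d, hh _ (H'.iterate_mem h0d m), mul_zero]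
      refine hsn _ (-m) hn ?_
      rw [H.halfPlaneCoord_inv_iterate h0d, zpow_neg, zpow_natCast]
  have hopen : ∀ l : ℂ, min Ra Rb < ‖l‖ → ‖l‖ < max Ra Rb → l ∈ spectrum ℂ T := by
    intro l h1 h2
    have hl0 : 0 < ‖l‖ := lt_trans (lt_min hRa0 hRb0) h1
    have hl : l ≠ 0 := norm_pos_iff.1 hl0
    rcases le_total Ra Rb with hle | hle
    · rw [min_eq_left hle] at h1
      rw [max_eq_right hle] at h2
      -- Here the forward half of the series converges since |l| > Ra, and the backward half since
      -- |l| < Rb, for every f.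
      obtain ⟨h, hh⟩ := S.exists_of_bounded hsd hCs
      refine mem_spectrum_of_summable_functional U hl e (fun f => ?_) (h := h) ?_
        (hvanish h fun z hz hz0 => by rw [hh z hz, hz0])
      · refine Summable.of_nat_of_neg ?_ ?_
        · refine (hT.summable_eval H W h1 h0d f).congr fun n => ?_
          rw [hUn, he, zpow_neg, zpow_natCast, inv_pow]
        · refine (hT'.summable_eval H' W' (l := l⁻¹) ?_ h0d f).congr fun n => ?_
          · rw [eB, norm_inv]; exact inv_strictAnti₀ hl0 h2
          · rw [hUn', he, neg_neg, zpow_natCast, inv_inv]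
      · rw [he, hh 0 h0d, hs0]; exact one_ne_zero
    · rw [min_eq_right hle] at h1
      rw [max_eq_left hle] at h2
      obtain ⟨R, hR1, hR2⟩ := exists_between h1
      have h2' : Ra⁻¹ < ‖l‖⁻¹ := inv_strictAnti₀ hl0 h2
      obtain ⟨R', hR1', hR2'⟩ := exists_between h2'
      have hR0 : 0 < R := hRb0.trans hR1
      have hR0' : 0 < R' := (inv_pos.2 hRa0).trans hR1'
      -- Zeros of order k at a and b push Ra/ρ^k below R and Rb⁻¹/ρ^k below R'. The other radii, Rb
      -- and Ra⁻¹, are already below R and R', where R < |l| and R' < |l|⁻¹, so both halves of the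
      -- orbit series are dominated by geometric series.
      obtain ⟨k₁, hk₁⟩ := pow_unbounded_of_one_lt (Ra / R) H.one_lt
      obtain ⟨k₂, hk₂⟩ := pow_unbounded_of_one_lt (Rb⁻¹ / R') H.one_lt
      set k := max k₁ k₂
      have hk1 : Ra / ρ ^ k < R := by
        have : ρ ^ k₁ ≤ ρ ^ k := pow_le_pow_right₀ H.one_lt.le (le_max_left _ _)
        rw [div_lt_iff₀ (by positivity)]
        rw [div_lt_iff₀ hR0] at hk₁
        nlinarith
      have hk2 : Rb⁻¹ / ρ ^ k < R' := by
        have : ρ ^ k₂ ≤ ρ ^ k := pow_le_pow_right₀ H.one_lt.le (le_max_right _ _)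
        rw [div_lt_iff₀ (by positivity)]
        rw [div_lt_iff₀ hR0'] at hk₂
        nlinarith
      have hCs0 : 0 ≤ Cs := (norm_nonneg _).trans (hCs 0 h0d)
      have hz2 : ∀ x : ℂ, ‖x‖ = 1 → ∀ z ∈ disc, ‖z - x‖ ≤ 2 := by
        intro x hx z hz
        have := norm_sub_le z x
        rw [hx] at this
        linarith [mem_disc.1 hz]
      set v : ℂ → ℂ := fun z => (z - a) ^ k * (z - b) ^ k * s z with hv
      have hvd : DifferentiableOn ℂ v disc := by
        refine DifferentiableOn.mul (Differentiable.differentiableOn ?_) hsd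
        fun_prop
      have hva : ∀ z ∈ disc, ‖v z‖ ≤ (2 ^ k * Cs) * ‖z - a‖ ^ k := by
        intro z hz
        have h3 := hz2 b H.norm_b z hz
        have h4 := hCs z hz
        rw [hv]
        simp only [norm_mul, norm_pow]
        calc _ ≤ ‖z - a‖ ^ k * 2 ^ k * Cs := by gcongr
          _ = _ := by ring
      have hvb : ∀ z ∈ disc, ‖v z‖ ≤ (2 ^ k * Cs) * ‖z - b‖ ^ k := by
        intro z hz
        have h3 := hz2 a H.norm_a z hz
        have h4 := hCs z hz
        rw [hv]
        simp only [norm_mul, norm_pow]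
        calc _ ≤ 2 ^ k * ‖z - b‖ ^ k * Cs := by gcongr
          _ = _ := by ring
      have hvbd : ∀ z ∈ disc, ‖v z‖ ≤ (2 ^ k * Cs) * 2 ^ k := by
        intro z hz
        refine (hva z hz).trans ?_
        have h3 := hz2 a H.norm_a z hz
        gcongr
      obtain ⟨h, hh⟩ := S.exists_of_bounded hvd hvbd
      obtain ⟨C, hC⟩ := hT.exists_norm_pow_apply_le H W (h := h) (D := 2 ^ k * Cs) hk1 hR1
        (fun z hz => by rw [hh z hz]; exact hva z hz)
      obtain ⟨C', hC'⟩ := hT'.exists_norm_pow_apply_le H' W' (h := h) (D := 2 ^ k * Cs)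
        (by rw [eB]; exact hk2) (by rw [eA]; exact hR1')
        (fun z hz => by rw [hh z hz]; exact hvb z hz)
      refine mem_spectrum_of_summable_orbit U hl e (h := h) ?_ ?_
        (hvanish h fun z hz hz0 => by rw [hh z hz, hv]; simp [hz0])
      · refine Summable.of_nat_of_neg ?_ ?_
        · have hg : Summable fun n : ℕ => C * (R / ‖l‖) ^ n :=
            (summable_geometric_of_lt_one (by positivity) ((div_lt_one hl0).2 hR2)).mul_left C
          refine Summable.of_norm_bounded hg fun n => ?_
          rw [norm_smul, hUn, zpow_neg, zpow_natCast, norm_inv, norm_pow, div_pow,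
            inv_mul_eq_div, mul_div_assoc']
          gcongr
          exact hC n
        · have hlt : ‖l‖ * R' < 1 := by
            rw [← lt_inv_mul_iff₀ hl0, mul_one]; exact hR2'
          have hg : Summable fun n : ℕ => C' * (‖l‖ * R') ^ n :=
            (summable_geometric_of_lt_one (by positivity) hlt).mul_left C'
          refine Summable.of_norm_bounded hg fun n => ?_
          rw [norm_smul, hUn', neg_neg, zpow_natCast, norm_pow, mul_pow, mul_left_comm]
          gcongr
          exact hC' n
      · rw [he, hh 0 h0d, hv]
        have ha0 : a ≠ 0 := by rintro rfl; simpa using H.norm_a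
        have hb0 : b ≠ 0 := by rintro rfl; simpa using H.norm_b
        simp [hs0, ha0, hb0]
  refine Set.Subset.antisymm (fun l hl => ⟨hlower l hl, hupper l hl⟩) ?_
  rintro l ⟨h1, h2⟩
  rcases eq_or_ne Ra Rb with heq | hne
  -- The open annulus is empty here; a spectral point exists by completeness and is rotated to l.
  · rw [heq, min_self] at h1
    rw [heq, max_self] at h2
    obtain ⟨l', hl'⟩ := spectrum.nonempty T
    have h1' := hlower l' hl'
    have h2' := hupper l' hl'
    rw [heq, min_self] at h1'
    rw [heq, max_self] at h2'
    have hn : ‖l‖ = ‖l'‖ := by linarith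
    have h3 := hT.exp_mul_mem_spectrum H hl' (l.arg - l'.arg)
    have h4 : Complex.exp ((l.arg - l'.arg : ℝ) * Complex.I) * l' = l := by
      calc _ = Complex.exp ((l.arg - l'.arg : ℝ) * Complex.I) *
            (‖l'‖ * Complex.exp (l'.arg * Complex.I)) := by rw [Complex.norm_mul_exp_arg_mul_I l']
        _ = ‖l‖ * Complex.exp (l.arg * Complex.I) := by
          rw [mul_left_comm, ← Complex.exp_add, hn]
          congr 2
          push_cast
          ring
        _ = l := Complex.norm_mul_exp_arg_mul_I l
    rwa [h4] at h3
  · have hlt : min Ra Rb < max Ra Rb := min_lt_max.2 hne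
    have hl0 : 0 < ‖l‖ := (lt_min hRa0 hRb0).trans_le h1
    -- The ray through l, parametrized by the modulus, along which l is approached from the open
    -- annulus.
    set F : ℝ → ℂ := fun t => (t / ‖l‖ : ℝ) * l with hF
    have hFc : Continuous F := by fun_prop
    have hcl : IsClosed (F ⁻¹' spectrum ℂ T) := (spectrum.isClosed T).preimage hFc
    have hsub : Set.Ioo (min Ra Rb) (max Ra Rb) ⊆ F ⁻¹' spectrum ℂ T := by
      intro t ht
      have ht0 : 0 < t := (lt_min hRa0 hRb0).trans ht.1
      have hFt : ‖F t‖ = t := by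
        rw [hF]
        simp only [norm_mul, Complex.norm_real]
        rw [Real.norm_of_nonneg (by positivity)]
        field_simp
      exact hopen _ (by rw [hFt]; exact ht.1) (by rw [hFt]; exact ht.2)
    have hmem : ‖l‖ ∈ F ⁻¹' spectrum ℂ T := by
      have := closure_minimal hsub hcl
      rw [closure_Ioo hlt.ne] at this
      exact this ⟨h1, h2⟩
    have hFl : F ‖l‖ = l := by
      rw [hF]
      simp [div_self hl0.ne']
    rwa [Set.mem_preimage, hFl] at hmem

end Spectrum

/-! ### Integral means over circles -/

/-- The integral of `|f|²` over the circle of radius `r`. -/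
def circleMean (f : ℂ → ℂ) (r : ℝ) : ℝ := ∫ θ in (0)..(2 * Real.pi), ‖f (circleMap 0 r θ)‖ ^ 2

lemma circleMap_mem_disc' {r : ℝ} (hr : r ∈ Set.Ico (0 : ℝ) 1) (θ : ℝ) :
    circleMap 0 r θ ∈ disc := by
  simp [abs_of_nonneg hr.1, hr.2]

lemma continuous_comp_circleMap {f : ℂ → ℂ} (hf : DifferentiableOn ℂ f disc) {r : ℝ}
    (hr : r ∈ Set.Ico (0 : ℝ) 1) : Continuous fun θ : ℝ => f (circleMap 0 r θ) :=
  hf.continuousOn.comp_continuous (continuous_circleMap 0 r) (circleMap_mem_disc' hr)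

lemma circleMean_nonneg (f : ℂ → ℂ) (r : ℝ) : 0 ≤ circleMean f r :=
  intervalIntegral.integral_nonneg (by positivity) fun _ _ => by positivity

lemma circleMean_shift (f : ℂ → ℂ) (r η : ℝ) :
    ∫ θ in (0)..(2 * Real.pi), ‖f (circleMap 0 r (θ + η))‖ ^ 2 = circleMean f r := by
  have hper : Function.Periodic (fun θ => ‖f (circleMap 0 r θ)‖ ^ 2) (2 * Real.pi) := fun θ => by
    simp only [periodic_circleMap 0 r θ]
  have h := hper.intervalIntegral_add_eq η 0
  rw [zero_add] at h
  rw [intervalIntegral.integral_comp_add_right (fun θ => ‖f (circleMap 0 r θ)‖ ^ 2),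
    add_comm (2 * Real.pi) η, zero_add, h, circleMean]

/-- Differentiation under the integral sign near x₀, on a closed ball of radius R < 1 where f' is
bounded. -/
lemma differentiableOn_circle_pairing {f : ℂ → ℂ} (hf : DifferentiableOn ℂ f disc) {v : ℝ → ℂ}
    (hv : Continuous v) :
    DifferentiableOn ℂ (fun x : ℂ => ∫ θ in (0)..(2 * Real.pi),
      f (x * Complex.exp (θ * Complex.I)) * v θ) disc := by
  intro x₀ hx₀
  have hx1 := mem_disc.1 hx₀
  obtain ⟨R, hR1, hR2⟩ := exists_between hx1
  have hcont : ∀ x ∈ disc, ∀ g : ℂ → ℂ, ContinuousOn g disc →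
      Continuous fun θ : ℝ => g (x * Complex.exp (θ * Complex.I)) := by
    intro x hx g hg
    refine hg.comp_continuous (by fun_prop) fun θ => ?_
    rw [mem_disc, norm_mul, Complex.norm_exp_ofReal_mul_I, mul_one]
    exact mem_disc.1 hx
  have hd : DifferentiableOn ℂ (deriv f) disc := hf.deriv isOpen_ball
  have hsub : closedBall (0 : ℂ) R ⊆ disc := closedBall_subset_ball hR2
  obtain ⟨C, hC⟩ := (isCompact_closedBall (0 : ℂ) R).exists_bound_of_continuousOn
    (hd.continuousOn.mono hsub)
  have hs : closedBall (0 : ℂ) R ∈ 𝓝 x₀ :=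
    mem_of_superset (isOpen_ball.mem_nhds (mem_ball_zero_iff.2 hR1)) ball_subset_closedBall
  have key := intervalIntegral.hasDerivAt_integral_of_dominated_loc_of_deriv_le (𝕜 := ℂ)
    (μ := volume) (a := 0) (b := 2 * Real.pi)
    (F := fun x θ => f (x * Complex.exp (θ * Complex.I)) * v θ)
    (F' := fun x θ => deriv f (x * Complex.exp (θ * Complex.I)) *
      (1 * Complex.exp (θ * Complex.I)) * v θ)
    (bound := fun θ => C * ‖v θ‖) hs ?_ ?_ ?_ ?_ ?_ ?_
  · exact key.2.differentiableAt.differentiableWithinAt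
  · filter_upwards [isOpen_ball.mem_nhds hx₀] with x hx
    exact ((hcont x hx f hf.continuousOn).mul hv).aestronglyMeasurable
  · exact ((hcont x₀ hx₀ f hf.continuousOn).mul hv).intervalIntegrable _ _
  · refine Continuous.aestronglyMeasurable ?_
    exact ((hcont x₀ hx₀ _ hd.continuousOn).mul (by fun_prop)).mul hv
  · refine Eventually.of_forall fun θ _ x hx => ?_
    rw [norm_mul, one_mul, norm_mul, Complex.norm_exp_ofReal_mul_I, mul_one]
    gcongr
    refine hC _ ?_
    simpa [Complex.norm_exp_ofReal_mul_I] using hx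
  · exact (continuous_const.mul hv.norm).intervalIntegrable _ _
  · refine Eventually.of_forall fun θ _ x hx => ?_
    have hmem : x * Complex.exp (θ * Complex.I) ∈ disc := by
      rw [mem_disc, norm_mul, Complex.norm_exp_ofReal_mul_I, mul_one]
      exact mem_disc.1 (hsub hx)
    have h1 : HasDerivAt f (deriv f (x * Complex.exp (θ * Complex.I)))
        (x * Complex.exp (θ * Complex.I)) :=
      (hf.differentiableAt (isOpen_ball.mem_nhds hmem)).hasDerivAt
    exact (h1.comp x ((hasDerivAt_id x).mul_const _)).mul_const _

/-- The integral means of a holomorphic function increase with the radius. -/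
theorem circleMean_mono {f : ℂ → ℂ} (hf : DifferentiableOn ℂ f disc) {r s : ℝ} (hr : 0 ≤ r)
    (hrs : r < s) (hs : s < 1) : circleMean f r ≤ circleMean f s := by
  have hr' : r ∈ Set.Ico (0 : ℝ) 1 := ⟨hr, hrs.trans hs⟩
  have hs' : s ∈ Set.Ico (0 : ℝ) 1 := ⟨hr.trans hrs.le, hs⟩
  have hs0 : 0 < s := hr.trans_lt hrs
  have hcr := continuous_comp_circleMap hf hr'
  have hpi : (0 : ℝ) ≤ 2 * Real.pi := by positivity
  have hv : Continuous fun θ : ℝ => conj (f (circleMap 0 r θ)) :=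
    Complex.continuous_conj.comp hcr
  -- G is holomorphic and G(r) is the mean at r. On |x| = s, 2|αβ| ≤ |α|² + |β|² bounds |G| by half
  -- the sum of the means at s and r, so the maximum principle gives the claim.
  set G : ℂ → ℂ := fun x => ∫ θ in (0)..(2 * Real.pi),
    f (x * Complex.exp (θ * Complex.I)) * conj (f (circleMap 0 r θ)) with hG
  have hGd := differentiableOn_circle_pairing hf hv
  have hGr : G r = (circleMean f r : ℂ) := by
    rw [hG, circleMean, ← intervalIntegral.integral_ofReal]
    refine intervalIntegral.integral_congr fun θ _ => ?_
    rw [circleMap_zero, Complex.mul_conj']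
    push_cast
    rfl
  have hbound : ∀ z ∈ frontier (ball (0 : ℂ) s), ‖G z‖ ≤ (circleMean f s + circleMean f r) / 2 := by
    intro z hz
    rw [frontier_ball _ hs0.ne', mem_sphere_zero_iff_norm] at hz
    have hzθ : ∀ θ : ℝ, z * Complex.exp (θ * Complex.I) = circleMap 0 s (θ + z.arg) := by
      intro θ
      rw [circleMap_zero, ← hz]
      conv_lhs => rw [← Complex.norm_mul_exp_arg_mul_I z]
      rw [mul_assoc, ← Complex.exp_add]
      push_cast
      ring_nf
    have hcs : Continuous fun θ : ℝ => f (circleMap 0 s (θ + z.arg)) :=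
      (continuous_comp_circleMap hf hs').comp (continuous_id.add continuous_const)
    have i1 : IntervalIntegrable (fun θ : ℝ => ‖f (circleMap 0 s (θ + z.arg))‖ ^ 2) volume 0
      (2 * Real.pi) := (hcs.norm.pow 2).intervalIntegrable _ _
    have i2 : IntervalIntegrable (fun θ : ℝ => ‖f (circleMap 0 r θ)‖ ^ 2) volume 0
      (2 * Real.pi) := (hcr.norm.pow 2).intervalIntegrable _ _
    rw [← circleMean_shift f s z.arg, circleMean, ← intervalIntegral.integral_add i1 i2,
      ← intervalIntegral.integral_div]
    refine intervalIntegral.norm_integral_le_of_norm_le hpi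
      (Eventually.of_forall fun θ _ => ?_) ((i1.add i2).div_const 2)
    rw [hzθ, norm_mul, RCLike.norm_conj]
    nlinarith [sq_nonneg (‖f (circleMap 0 s (θ + z.arg))‖ - ‖f (circleMap 0 r θ)‖)]
  have hdc : DiffContOnCl ℂ G (ball 0 s) := by
    refine (hGd.mono ?_).diffContOnCl
    rw [closure_ball _ hs0.ne']
    exact closedBall_subset_ball hs
  have hmem : (r : ℂ) ∈ closure (ball (0 : ℂ) s) := by
    refine subset_closure ?_
    simpa [abs_of_nonneg hr] using hrs
  have h1 := Complex.norm_le_of_forall_mem_frontier_norm_le isBounded_ball hdc hbound hmem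
  rw [hGr, Complex.norm_real, Real.norm_of_nonneg (circleMean_nonneg f r)] at h1
  linarith

lemma circleMean_zero (f : ℂ → ℂ) : circleMean f 0 = 2 * Real.pi * ‖f 0‖ ^ 2 := by
  simp [circleMean]

lemma ofReal_integral_circle {f : ℂ → ℂ} (hf : DifferentiableOn ℂ f disc) {r : ℝ}
    (hr : r ∈ Set.Ico (0 : ℝ) 1) {x y : ℝ} (hxy : x ≤ y) :
    ∫⁻ θ in Set.Ioc x y, ‖f (circleMap 0 r θ)‖ₑ ^ 2
      = ENNReal.ofReal (∫ θ in x..y, ‖f (circleMap 0 r θ)‖ ^ 2) := by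
  have hc : Continuous fun θ : ℝ => ‖f (circleMap 0 r θ)‖ ^ 2 :=
    (continuous_comp_circleMap hf hr).norm.pow 2
  rw [intervalIntegral.integral_of_le hxy, ofReal_integral_eq_lintegral_ofReal
    ((intervalIntegrable_iff_integrableOn_Ioc_of_le hxy).1 (hc.intervalIntegrable _ _))
    (Eventually.of_forall fun θ => by positivity)]
  refine lintegral_congr fun θ => ?_
  rw [ENNReal.ofReal_pow (norm_nonneg _), ofReal_norm]

lemma circleNorm_sq {f : ℂ → ℂ} (hf : DifferentiableOn ℂ f disc) {r : ℝ}
    (hr : r ∈ Set.Ico (0 : ℝ) 1) :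
    circleNorm r f ^ 2 = ENNReal.ofReal ((2 * Real.pi)⁻¹ * circleMean f r) := by
  have h := eLpNorm_nnreal_pow_eq_lintegral (μ := arcMeasure) (p := 2) two_ne_zero
    (f := fun θ : ℝ => f (circleMap 0 r θ))
  have hpi : (0 : ℝ) ≤ 2 * Real.pi := by positivity
  simp only [NNReal.coe_ofNat, ENNReal.coe_ofNat, ENNReal.rpow_ofNat] at h
  rw [circleNorm, h, arcMeasure, lintegral_smul_measure, ofReal_integral_circle hf hr hpi,
    smul_eq_mul, ← ENNReal.ofReal_mul (by positivity)]
  rfl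

/-! ### The weighted Bergman norm in polar coordinates -/

lemma measurable_of_mem_holo {f : ℂ → ℂ} (hf : f ∈ holo) : Measurable f := by
  classical
  have h1 : f = disc.indicator f := by
    funext z
    by_cases hz : z ∈ disc
    · rw [Set.indicator_of_mem hz]
    · rw [Set.indicator_of_notMem hz, hf.2 z hz]
  rw [h1, ← Set.piecewise_eq_indicator]
  exact hf.1.continuousOn.measurable_piecewise continuousOn_const measurableSet_ball

lemma bergmanENorm_sq {f : ℂ → ℂ} (hf : f ∈ holo) (α : ℝ) :
    bergmanENorm α f ^ 2 = ∫⁻ z in disc,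
      ENNReal.ofReal ((α + 1) / Real.pi * (1 - ‖z‖ ^ 2) ^ α) * ‖f z‖ₑ ^ 2 := by
  have h := eLpNorm_nnreal_pow_eq_lintegral (μ := bergmanMeasure α) (p := 2) two_ne_zero (f := f)
  simp only [NNReal.coe_ofNat, ENNReal.coe_ofNat, ENNReal.rpow_ofNat] at h
  have hm := measurable_of_mem_holo hf
  rw [bergmanENorm, h, bergmanMeasure, lintegral_withDensity_eq_lintegral_mul _ (by fun_prop)
    (by fun_prop)]
  rfl

/-- The factor 2(α+1) is (α+1)/π times the 2π by which `circleNorm` is normalized. -/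
lemma bergmanENorm_sq_polar {f : ℂ → ℂ} (hf : f ∈ holo) {α : ℝ} (hα : -1 < α) :
    bergmanENorm α f ^ 2 = ∫⁻ r in Set.Ioo (0 : ℝ) 1,
      ENNReal.ofReal (2 * (α + 1) * r * (1 - r ^ 2) ^ α) * circleNorm r f ^ 2 := by
  have hm := measurable_of_mem_holo hf
  have hα' : 0 < α + 1 := by linarith
  set g : ℂ → ℝ≥0∞ := disc.indicator fun z =>
    ENNReal.ofReal ((α + 1) / Real.pi * (1 - ‖z‖ ^ 2) ^ α) * ‖f z‖ₑ ^ 2 with hg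
  have hgm : Measurable g := by
    refine Measurable.indicator ?_ measurableSet_ball
    fun_prop
  have hsymm : ∀ q : ℝ × ℝ, Complex.polarCoord.symm q = circleMap 0 q.1 q.2 := fun q => by
    rw [Complex.polarCoord_symm_apply, circleMap_zero, Complex.exp_mul_I]
    push_cast
    ring
  have hstep : bergmanENorm α f ^ 2 = ∫⁻ z, g z := by
    rw [bergmanENorm_sq hf, hg, lintegral_indicator measurableSet_ball]
  rw [hstep, ← Complex.lintegral_comp_polarCoord_symm, polarCoord_target, Measure.volume_eq_prod,
    setLIntegral_prod]
  · rw [← Set.Ioo_union_Ici_eq_Ioi (zero_lt_one' ℝ), lintegral_union measurableSet_Ici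
      (Set.disjoint_left.2 fun x h1 h2 => not_le.2 h1.2 h2)]
    have hzero : ∫⁻ r in Set.Ici (1 : ℝ), ∫⁻ θ in Set.Ioo (-Real.pi) Real.pi,
        ENNReal.ofReal (r, θ).1 • g (Complex.polarCoord.symm (r, θ)) = 0 := by
      rw [setLIntegral_congr_fun measurableSet_Ici (g := fun _ => 0)]
      · simp
      · intro r hr
        simp only
        have : ∀ θ : ℝ, g (Complex.polarCoord.symm (r, θ)) = 0 := fun θ => by
          rw [hsymm, hg, Set.indicator_of_notMem]
          have hr1 : (1 : ℝ) ≤ r := hr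
          rw [mem_disc]
          simpa using hr1.trans (le_abs_self r)
        simp only [this, smul_zero, lintegral_zero]
    rw [hzero, add_zero]
    refine setLIntegral_congr_fun measurableSet_Ioo fun r hr => ?_
    have hr' : r ∈ Set.Ico (0 : ℝ) 1 := ⟨hr.1.le, hr.2⟩
    have hr2 : 0 < 1 - r ^ 2 := by nlinarith [hr.1, hr.2]
    have hpw := Real.rpow_nonneg hr2.le α
    have hr0 := hr.1
    have hgv : ∀ θ : ℝ, ENNReal.ofReal r • g (Complex.polarCoord.symm (r, θ)) =
        ENNReal.ofReal (r * ((α + 1) / Real.pi * (1 - r ^ 2) ^ α)) *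
          ‖f (circleMap 0 r θ)‖ₑ ^ 2 := by
      intro θ
      rw [hsymm, hg, Set.indicator_of_mem (circleMap_mem_disc' hr' θ), norm_circleMap_zero, sq_abs,
        smul_eq_mul, ← mul_assoc, ← ENNReal.ofReal_mul hr.1.le]
    simp only [hgv]
    have hcont := continuous_comp_circleMap hf.1 hr'
    rw [lintegral_const_mul _ (by fun_prop), circleNorm_sq hf.1 hr',
      setLIntegral_congr Ioo_ae_eq_Ioc,
      ofReal_integral_circle hf.1 hr' (by linarith [Real.pi_pos]),
      ← ENNReal.ofReal_mul (by positivity), ← ENNReal.ofReal_mul (by positivity)]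
    have hper : Function.Periodic (fun θ => ‖f (circleMap 0 r θ)‖ ^ 2) (2 * Real.pi) := fun θ => by
      simp only [periodic_circleMap 0 r θ]
    have hint : ∫ θ in (-Real.pi)..Real.pi, ‖f (circleMap 0 r θ)‖ ^ 2 = circleMean f r := by
      have := hper.intervalIntegral_add_eq (-Real.pi) 0
      rw [show -Real.pi + 2 * Real.pi = Real.pi by ring, zero_add] at this
      exact this
    rw [hint]
    congr 1
    field_simp
  · refine Measurable.aemeasurable ?_
    refine Measurable.smul (ENNReal.measurable_ofReal.comp measurable_fst) (hgm.comp ?_)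
    rw [funext hsymm]
    simp only [circleMap_zero]
    fun_prop

lemma lintegral_radial {α : ℝ} (hα : -1 < α) {s : ℝ} (hs : s ∈ Set.Ico (0 : ℝ) 1) :
    ∫⁻ r in Set.Ioo s 1, ENNReal.ofReal (2 * (α + 1) * r * (1 - r ^ 2) ^ α)
      = ENNReal.ofReal ((1 - s ^ 2) ^ (α + 1)) := by
  have hα' : 0 < α + 1 := by linarith
  set G : ℝ → ℝ := fun r => -(1 - r ^ 2) ^ (α + 1) with hG
  have hcont : ContinuousOn G (Set.Icc s 1) := by
    refine Continuous.continuousOn ?_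
    exact ((continuous_const.sub (continuous_id.pow 2)).rpow_const fun _ => Or.inr hα'.le).neg
  have hderiv : ∀ r ∈ Set.Ioo s 1,
      HasDerivAt G (2 * (α + 1) * r * (1 - r ^ 2) ^ α) r := by
    intro r hr
    have hr2 : 0 < 1 - r ^ 2 := by nlinarith [hr.1, hr.2, hs.1]
    have h1 : HasDerivAt (fun r : ℝ => 1 - r ^ 2) (-(2 * r)) r := by
      simpa using (hasDerivAt_pow 2 r).const_sub 1
    refine (h1.rpow_const (p := α + 1) (Or.inl hr2.ne')).neg.congr_deriv ?_
    rw [add_sub_cancel_right]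
    ring
  have hpos : ∀ r ∈ Set.Ioo s 1, 0 ≤ 2 * (α + 1) * r * (1 - r ^ 2) ^ α := by
    intro r hr
    have hr2 : 0 < 1 - r ^ 2 := by nlinarith [hr.1, hr.2, hs.1]
    have hr0 : 0 < r := hs.1.trans_lt hr.1
    have := Real.rpow_nonneg hr2.le α
    positivity
  -- For α < 0 the integrand is unbounded at 1; integrability comes from its sign and the continuity
  -- of the antiderivative.
  have hint := intervalIntegral.integrableOn_deriv_of_nonneg hcont hderiv hpos
  have hval := intervalIntegral.integral_eq_sub_of_hasDerivAt_of_le hs.2.le hcont hderiv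
    ((intervalIntegrable_iff_integrableOn_Ioc_of_le hs.2.le).2 hint)
  rw [intervalIntegral.integral_of_le hs.2.le, integral_Ioc_eq_integral_Ioo] at hval
  rw [← ofReal_integral_eq_lintegral_ofReal (hint.mono_set Set.Ioo_subset_Ioc_self)
    ((ae_restrict_iff' measurableSet_Ioo).2 (Eventually.of_forall hpos)), hval]
  simp only [hG]
  rw [one_pow, sub_self, Real.zero_rpow hα'.ne']
  congr 1
  ring

lemma bergmanENorm_le_hardyENorm {f : ℂ → ℂ} (hf : f ∈ holo) {α : ℝ} (hα : -1 < α) :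
    bergmanENorm α f ≤ hardyENorm f := by
  rw [← ENNReal.pow_le_pow_left_iff two_ne_zero, bergmanENorm_sq_polar hf hα]
  calc _ ≤ ∫⁻ r in Set.Ioo (0 : ℝ) 1,
        ENNReal.ofReal (2 * (α + 1) * r * (1 - r ^ 2) ^ α) * hardyENorm f ^ 2 := by
        refine setLIntegral_mono' measurableSet_Ioo fun r hr => ?_
        gcongr
        exact le_iSup (fun r : Set.Ioo (0 : ℝ) 1 => circleNorm r f) ⟨r, hr⟩
    _ = hardyENorm f ^ 2 := by
        rw [lintegral_mul_const _ (by fun_prop), lintegral_radial hα ⟨le_rfl, one_pos⟩]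
        simp

/-- Discard the radii below s and use monotonicity of the means. As α → -1 the factor tends to 1, so
Bergman bounds pass to circles and hence to the Hardy norm. -/
lemma circleNorm_le_bergmanENorm {f : ℂ → ℂ} (hf : f ∈ holo) {α : ℝ} (hα : -1 < α) {s : ℝ}
    (hs : s ∈ Set.Ico (0 : ℝ) 1) :
    ENNReal.ofReal ((1 - s ^ 2) ^ (α + 1)) * circleNorm s f ^ 2 ≤ bergmanENorm α f ^ 2 := by
  rw [bergmanENorm_sq_polar hf hα, ← lintegral_radial hα hs,
    ← lintegral_mul_const _ (by fun_prop)]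
  calc _ ≤ ∫⁻ r in Set.Ioo s 1,
        ENNReal.ofReal (2 * (α + 1) * r * (1 - r ^ 2) ^ α) * circleNorm r f ^ 2 := by
        refine setLIntegral_mono' measurableSet_Ioo fun r hr => ?_
        refine mul_le_mul_right ?_ _
        rw [circleNorm_sq hf.1 hs, circleNorm_sq hf.1 ⟨hs.1.trans hr.1.le, hr.2⟩]
        gcongr
        exact circleMean_mono hf.1 hs.1 hr.1 hr.2
    _ ≤ _ := lintegral_mono_set (Set.Ioo_subset_Ioo_left hs.1)

lemma enorm_zero_le_bergmanENorm {f : ℂ → ℂ} (hf : f ∈ holo) {α : ℝ} (hα : -1 < α) :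
    ‖f 0‖ₑ ≤ bergmanENorm α f := by
  have h := circleNorm_le_bergmanENorm hf hα (s := 0) ⟨le_rfl, one_pos⟩
  rw [circleNorm_sq hf.1 ⟨le_rfl, one_pos⟩, circleMean_zero] at h
  rw [← ENNReal.pow_le_pow_left_iff two_ne_zero]
  refine le_trans (le_of_eq ?_) h
  rw [inv_mul_cancel_left₀ (by positivity), ENNReal.ofReal_pow (norm_nonneg _), ofReal_norm]
  simp

/-! ### Norm estimates for weighted composition -/

/-- The function `ψ · (f ∘ φ)` on the disc, extended by zero. -/
def weightedComp (φ ψ f : ℂ → ℂ) : ℂ → ℂ := disc.indicator fun z => ψ z * f (φ z)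

lemma weightedComp_apply {φ ψ f : ℂ → ℂ} {z : ℂ} (hz : z ∈ disc) :
    weightedComp φ ψ f z = ψ z * f (φ z) := Set.indicator_of_mem hz _

lemma weightedComp_mem_holo {φ ψ f : ℂ → ℂ} (hφ : IsDiscIsometry φ)
    (hψ : DifferentiableOn ℂ ψ disc) (hf : f ∈ holo) : weightedComp φ ψ f ∈ holo := by
  refine ⟨DifferentiableOn.congr ?_ fun z hz => weightedComp_apply hz,
    fun z hz => Set.indicator_of_notMem hz _⟩
  exact hψ.mul (hf.1.comp hφ.differentiableOn hφ.bijOn.mapsTo)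

/-- Change of variables: the real Jacobian determinant of a holomorphic map is |φ'|². -/
lemma lintegral_disc_comp {φ : ℂ → ℂ} (hφ : IsDiscIsometry φ) (g : ℂ → ℝ≥0∞) :
    ∫⁻ z in disc, g z = ∫⁻ z in disc, ENNReal.ofReal (‖deriv φ z‖ ^ 2) * g (φ z) := by
  have h := lintegral_image_eq_lintegral_abs_det_fderiv_mul volume (s := disc) (f := φ)
    (f' := fun z => (ContinuousLinearMap.toSpanSingleton ℂ (deriv φ z)).restrictScalars ℝ)
    measurableSet_ball (fun z hz =>
      ((hφ.differentiableOn.differentiableAt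
        (isOpen_ball.mem_nhds hz)).hasDerivAt.hasFDerivAt.restrictScalars ℝ).hasFDerivWithinAt)
    hφ.bijOn.injOn g
  rw [hφ.bijOn.image_eq] at h
  rw [h]
  refine lintegral_congr fun z => ?_
  congr 2
  simp [ContinuousLinearMap.det, LinearMap.det_restrictScalars,
      Algebra.norm_complex_eq, Complex.normSq_eq_norm_sq]

/-- After the substitution the integrands compare pointwise. In 2γ = α + 2 the α comes from the
weight and the 2 from the Jacobian, through |φ'|(1 - |z|²) = 1 - |φ|². -/
lemma bergmanENorm_weightedComp_le {φ ψ f : ℂ → ℂ} (hφ : IsDiscIsometry φ)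
    (hψ : DifferentiableOn ℂ ψ disc) (hf : f ∈ holo) {α M : ℝ} (hα : -1 < α) (hM : 0 ≤ M)
    (h : ∀ z ∈ disc, ‖ψ z‖ * (1 - ‖z‖ ^ 2) ^ ((α + 2) / 2)
      ≤ M * (1 - ‖φ z‖ ^ 2) ^ ((α + 2) / 2)) :
    bergmanENorm α (weightedComp φ ψ f) ≤ ENNReal.ofReal M * bergmanENorm α f := by
  have hα' : 0 < α + 1 := by linarith
  rw [← ENNReal.pow_le_pow_left_iff two_ne_zero, mul_pow,
    bergmanENorm_sq (weightedComp_mem_holo hφ hψ hf), bergmanENorm_sq hf,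
    lintegral_disc_comp hφ fun z =>
      ENNReal.ofReal ((α + 1) / Real.pi * (1 - ‖z‖ ^ 2) ^ α) * ‖f z‖ₑ ^ 2,
    ← lintegral_const_mul' _ _ (by simp)]
  refine setLIntegral_mono' measurableSet_ball fun z hz => ?_
  have hd := one_sub_norm_sq_pos hz
  have hd' := one_sub_norm_sq_pos (hφ.bijOn.mapsTo hz)
  rw [weightedComp_apply hz, enorm_mul, mul_pow, ← mul_assoc, ← mul_assoc, ← mul_assoc,
    ← ENNReal.ofReal_pow hM, ← ENNReal.ofReal_mul (by positivity),
    ← ofReal_norm (ψ z), ← ENNReal.ofReal_pow (norm_nonneg _)]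
  have hw := Real.rpow_nonneg hd.le α
  have hw' := Real.rpow_nonneg hd'.le α
  rw [← ENNReal.ofReal_mul (by positivity), ← ENNReal.ofReal_mul (by positivity)]
  refine mul_le_mul_left (ENNReal.ofReal_le_ofReal ?_) _
  have hsq : ∀ t : ℝ, 0 < t → (t ^ ((α + 2) / 2)) ^ 2 = t ^ α * t ^ 2 := by
    intro t ht
    rw [← Real.rpow_natCast, ← Real.rpow_mul ht.le, ← Real.rpow_natCast t 2,
      ← Real.rpow_add ht]
    norm_num
  have hnd := hφ.norm_deriv z hz
  have h1 := pow_le_pow_left₀ (by positivity) (h z hz) 2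
  rw [mul_pow, mul_pow, hsq _ hd, hsq _ hd'] at h1
  have h2 : ‖ψ z‖ ^ 2 * (1 - ‖z‖ ^ 2) ^ α
      ≤ M ^ 2 * ((1 - ‖φ z‖ ^ 2) ^ α * ‖deriv φ z‖ ^ 2) := by
    refine le_of_mul_le_mul_right ?_ (pow_pos hd 2)
    calc _ = ‖ψ z‖ ^ 2 * ((1 - ‖z‖ ^ 2) ^ α * (1 - ‖z‖ ^ 2) ^ 2) := by ring
      _ ≤ _ := h1
      _ = _ := by rw [← hnd, mul_pow]; ring
  have hc : 0 ≤ (α + 1) / Real.pi := by positivity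
  calc _ = (α + 1) / Real.pi * (‖ψ z‖ ^ 2 * (1 - ‖z‖ ^ 2) ^ α) := by ring
    _ ≤ (α + 1) / Real.pi * (M ^ 2 * ((1 - ‖φ z‖ ^ 2) ^ α * ‖deriv φ z‖ ^ 2)) := by gcongr
    _ = _ := by ring

/-- Apply the Bergman estimate with α = t - 1, where the bound worsens to M·K^{t/2}, and let t → 0⁺
on each fixed circle. -/
lemma hardyENorm_weightedComp_le {φ ψ f : ℂ → ℂ} (hφ : IsDiscIsometry φ)
    (hψ : DifferentiableOn ℂ ψ disc) (hf : f ∈ hardySubmodule) {M : ℝ} (hM : 0 ≤ M)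
    (h : ∀ z ∈ disc, ‖ψ z‖ * (1 - ‖z‖ ^ 2) ^ (1 / 2 : ℝ) ≤ M * (1 - ‖φ z‖ ^ 2) ^ (1 / 2 : ℝ)) :
    hardyENorm (weightedComp φ ψ f) ≤ ENNReal.ofReal M * hardyENorm f := by
  obtain ⟨K, hK, hKle⟩ := hφ.exists_le
  have hg := weightedComp_mem_holo hφ hψ hf.1
  refine iSup_le fun ⟨r, hr⟩ => ?_
  have hr' : r ∈ Set.Ico (0 : ℝ) 1 := ⟨hr.1.le, hr.2⟩
  have hr2 : 0 < 1 - r ^ 2 := by nlinarith [hr.1, hr.2]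
  rw [← ENNReal.pow_le_pow_left_iff two_ne_zero]
  have key : ∀ t : ℝ, 0 < t → ENNReal.ofReal ((1 - r ^ 2) ^ t) *
      circleNorm r (weightedComp φ ψ f) ^ 2
        ≤ ENNReal.ofReal (M * K ^ (t / 2)) ^ 2 * hardyENorm f ^ 2 := by
    intro t ht
    have hα : -1 < t - 1 := by linarith
    have h1 := circleNorm_le_bergmanENorm hg hα hr'
    rw [sub_add_cancel] at h1
    refine h1.trans ?_
    rw [← mul_pow]
    gcongr
    refine (bergmanENorm_weightedComp_le hφ hψ hf.1 hα (M := M * K ^ (t / 2)) (by positivity)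
      fun z hz => ?_).trans ?_
    · have hd := one_sub_norm_sq_pos hz
      have hd' := one_sub_norm_sq_pos (hφ.bijOn.mapsTo hz)
      rw [show (t - 1 + 2) / 2 = 1 / 2 + t / 2 by ring, Real.rpow_add hd, Real.rpow_add hd']
      have h2 : (1 - ‖z‖ ^ 2) ^ (t / 2) ≤ K ^ (t / 2) * (1 - ‖φ z‖ ^ 2) ^ (t / 2) := by
        rw [← Real.mul_rpow hK.le hd'.le]
        exact Real.rpow_le_rpow hd.le (hKle z hz) (by positivity)
      calc _ = (‖ψ z‖ * (1 - ‖z‖ ^ 2) ^ (1 / 2 : ℝ)) * (1 - ‖z‖ ^ 2) ^ (t / 2) := by ring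
        _ ≤ (M * (1 - ‖φ z‖ ^ 2) ^ (1 / 2 : ℝ)) * (K ^ (t / 2) * (1 - ‖φ z‖ ^ 2) ^ (t / 2)) :=
          mul_le_mul (h z hz) h2 (Real.rpow_nonneg hd.le _)
            (mul_nonneg hM (Real.rpow_nonneg hd'.le _))
        _ = _ := by ring
    · gcongr
      exact bergmanENorm_le_hardyENorm hf.1 hα
  have hcn : circleNorm r (weightedComp φ ψ f) ^ 2 ≠ ∞ := by
    rw [circleNorm_sq hg.1 hr']; exact ENNReal.ofReal_ne_top
  have t1 : Tendsto (fun t : ℝ => ENNReal.ofReal ((1 - r ^ 2) ^ t) *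
      circleNorm r (weightedComp φ ψ f) ^ 2) (𝓝[>] 0)
      (𝓝 (ENNReal.ofReal ((1 - r ^ 2) ^ (0 : ℝ)) * circleNorm r (weightedComp φ ψ f) ^ 2)) := by
    refine ENNReal.Tendsto.mul_const (ENNReal.tendsto_ofReal ?_) (Or.inr hcn)
    exact ((Real.continuous_const_rpow hr2.ne').tendsto 0).mono_left nhdsWithin_le_nhds
  have t2 : Tendsto (fun t : ℝ => ENNReal.ofReal (M * K ^ (t / 2)) ^ 2 * hardyENorm f ^ 2) (𝓝[>] 0)
      (𝓝 (ENNReal.ofReal (M * K ^ ((0 : ℝ) / 2)) ^ 2 * hardyENorm f ^ 2)) := by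
    refine ENNReal.Tendsto.mul_const (ENNReal.Tendsto.pow (ENNReal.tendsto_ofReal ?_))
      (Or.inr (ENNReal.pow_ne_top hf.2.ne))
    have : Continuous fun t : ℝ => M * K ^ (t / 2) :=
      continuous_const.mul ((Real.continuous_const_rpow hK.ne').comp (by fun_prop))
    exact (this.tendsto 0).mono_left nhdsWithin_le_nhds
  have hlim := le_of_tendsto_of_tendsto t1 t2
    (by filter_upwards [self_mem_nhdsWithin] with t ht using key t ht)
  rw [Real.rpow_zero, zero_div, Real.rpow_zero, mul_one, ENNReal.ofReal_one, one_mul,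
    ← mul_pow] at hlim
  exact hlim

/-! ### Completeness -/

/-- Point evaluation bounds make a Cauchy sequence converge locally uniformly, so the limit F is
holomorphic. The Fatou property `hS`, applied to differences of terms, shows that F minus a late
term lies in the space with small norm. -/
lemma DiscSpace.completeSpace {E : Type*} [NormedAddCommGroup E] [NormedSpace ℂ E] {γ : ℝ}
    (S : DiscSpace E γ)
    (hS : ∀ (v : ℕ → E) (F : ℂ → ℂ) (R : ℝ), F ∈ holo →
      (∀ z ∈ disc, Tendsto (fun n => S.ev (v n) z) atTop (𝓝 (F z))) → (∀ n, ‖v n‖ ≤ R) →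
      ∃ g, S.ev g = F ∧ ‖g‖ ≤ R) : CompleteSpace E := by
  refine Metric.complete_of_cauchySeq_tendsto fun w hw => ?_
  obtain ⟨C, hC, hbd⟩ := S.exists_norm_le
  have hpt : ∀ z ∈ disc, CauchySeq fun n => S.ev (w n) z := by
    intro z hz
    obtain ⟨e, he⟩ := S.exists_evCLM hz
    have := e.uniformContinuous.comp_cauchySeq hw
    simpa only [Function.comp_def, he] using this
  have hlim : ∀ z, ∃ x, z ∈ disc → Tendsto (fun n => S.ev (w n) z) atTop (𝓝 x) := by
    intro z
    by_cases hz : z ∈ disc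
    · obtain ⟨x, hx⟩ := cauchySeq_tendsto_of_complete (hpt z hz)
      exact ⟨x, fun _ => hx⟩
    · exact ⟨0, fun h => absurd h hz⟩
  choose F₀ hF₀ using hlim
  set F : ℂ → ℂ := disc.indicator F₀ with hF
  have hFt : ∀ z ∈ disc, Tendsto (fun n => S.ev (w n) z) atTop (𝓝 (F z)) := by
    intro z hz
    rw [hF, Set.indicator_of_mem hz]
    exact hF₀ z hz
  have hunif : TendstoLocallyUniformlyOn (fun n => S.ev (w n)) F atTop disc := by
    rw [tendstoLocallyUniformlyOn_iff_forall_isCompact isOpen_ball]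
    intro K hK hKc
    have huc : UniformCauchySeqOn (fun n => S.ev (w n)) atTop K := by
      obtain ⟨D, hD⟩ : ∃ D : ℝ, ∀ z ∈ K, ((1 - ‖z‖ ^ 2) ^ γ)⁻¹ ≤ D := by
        have hc : ContinuousOn (fun z : ℂ => ((1 - ‖z‖ ^ 2) ^ γ)⁻¹) K := by
          refine ContinuousOn.inv₀ (ContinuousOn.rpow_const (by fun_prop) fun z hz => ?_)
            fun z hz => ?_
          · exact Or.inl (one_sub_norm_sq_pos (hK hz)).ne'
          · exact (Real.rpow_pos_of_pos (one_sub_norm_sq_pos (hK hz)) _).ne'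
        obtain ⟨D, hD⟩ := hKc.exists_bound_of_continuousOn hc
        exact ⟨D, fun z hz => (le_abs_self _).trans (hD z hz)⟩
      rw [Metric.uniformCauchySeqOn_iff]
      intro ε hε
      obtain ⟨N, hN⟩ := Metric.cauchySeq_iff.1 hw (ε / (C * (|D| + 1))) (by positivity)
      refine ⟨N, fun m hm n hn z hz => ?_⟩
      have hpow := Real.rpow_pos_of_pos (one_sub_norm_sq_pos (hK hz)) γ
      have h1 := hbd (w m - w n) z (hK hz)
      have h2 := hN m hm n hn
      rw [dist_eq_norm, lt_div_iff₀ (by positivity)] at h2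
      rw [dist_eq_norm, ← Pi.sub_apply, ← map_sub]
      rw [← le_div_iff₀ hpow, div_eq_mul_inv] at h1
      refine h1.trans_lt (lt_of_le_of_lt ?_ h2)
      have h3 : ((1 - ‖z‖ ^ 2) ^ γ)⁻¹ ≤ |D| + 1 := (hD z hz).trans (by linarith [le_abs_self D])
      calc _ ≤ C * ‖w m - w n‖ * (|D| + 1) := by gcongr
        _ = _ := by ring
    exact huc.tendstoUniformlyOn_of_tendsto fun z hz => hFt z (hK hz)
  have hFh : F ∈ holo := ⟨hunif.differentiableOn (Eventually.of_forall fun n => (S.ev_mem _).1)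
    isOpen_ball, fun z hz => Set.indicator_of_notMem hz _⟩
  have hstep : ∀ (N : ℕ) (ε : ℝ), (∀ m ≥ N, ∀ n ≥ N, ‖w m - w n‖ ≤ ε) → ∀ n ≥ N,
      ∃ g, S.ev g = F - S.ev (w n) ∧ ‖g‖ ≤ ε := by
    intro N ε hN n hn
    refine hS (fun m => w (m + N) - w n) (F - S.ev (w n)) ε
      (holo.sub_mem hFh (S.ev_mem _)) (fun z hz => ?_) (fun m => hN _ (by lia) n hn)
    simp only [map_sub, Pi.sub_apply]
    exact ((tendsto_add_atTop_iff_nat N).2 (hFt z hz)).sub_const _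
  obtain ⟨N₁, hN₁⟩ := Metric.cauchySeq_iff.1 hw 1 one_pos
  obtain ⟨g₁, hg₁, -⟩ := hstep N₁ 1 (fun m hm n hn => by
    rw [← dist_eq_norm]; exact (hN₁ m hm n hn).le) N₁ le_rfl
  refine ⟨w N₁ + g₁, Metric.tendsto_atTop.2 fun ε hε => ?_⟩
  obtain ⟨N, hN⟩ := Metric.cauchySeq_iff.1 hw (ε / 2) (by positivity)
  refine ⟨N, fun n hn => ?_⟩
  obtain ⟨g, hg, hgn⟩ := hstep N (ε / 2) (fun m hm n hn => by
    rw [← dist_eq_norm]; exact (hN m hm n hn).le) n hn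
  have heq : w N₁ + g₁ - w n = g := S.ev_injective (by rw [map_sub, map_add, hg₁, hg]; abel)
  rw [dist_comm, dist_eq_norm, heq]
  linarith

lemma bergmanENorm_le_of_tendsto {v : ℕ → ℂ → ℂ} {F : ℂ → ℂ} {α : ℝ} {R : ℝ≥0∞}
    (hv : ∀ n, v n ∈ holo) (hlim : ∀ z ∈ disc, Tendsto (fun n => v n z) atTop (𝓝 (F z)))
    (hR : ∀ n, bergmanENorm α (v n) ≤ R) : bergmanENorm α F ≤ R := by
  have hae : ∀ᵐ z ∂bergmanMeasure α, z ∈ disc :=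
    (withDensity_absolutelyContinuous _ _).ae_le (ae_restrict_mem measurableSet_ball)
  refine (Lp.eLpNorm_lim_le_liminf_eLpNorm (fun n => holo_aestronglyMeasurable (hv n) α) F
    (hae.mono fun z hz => hlim z hz)).trans ?_
  exact liminf_le_of_le (by isBoundedDefault) fun b hb => by
    obtain ⟨n, hn⟩ := hb.exists
    exact hn.trans (hR n)

lemma hardyENorm_le_of_tendsto {v : ℕ → ℂ → ℂ} {F : ℂ → ℂ} {R : ℝ≥0∞}
    (hv : ∀ n, v n ∈ holo) (hlim : ∀ z ∈ disc, Tendsto (fun n => v n z) atTop (𝓝 (F z)))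
    (hR : ∀ n, hardyENorm (v n) ≤ R) : hardyENorm F ≤ R := by
  refine iSup_le fun r => ?_
  refine (Lp.eLpNorm_lim_le_liminf_eLpNorm
    (fun n => (continuous_circle (hv n) r.2).aestronglyMeasurable) _
    (Eventually.of_forall fun θ => hlim _ (circleMap_mem_disc r.2 θ))).trans ?_
  exact liminf_le_of_le (by isBoundedDefault) fun b hb => by
    obtain ⟨n, hn⟩ := hb.exists
    exact hn.trans ((le_iSup (fun r : Set.Ioo (0 : ℝ) 1 => circleNorm r (v n)) r).trans (hR n))

/-! ### The Hardy space and the Bergman spaces -/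

lemma indicator_one_mem_holo : disc.indicator (fun _ => (1 : ℂ)) ∈ holo :=
  ⟨(differentiableOn_const 1).congr fun _ hz => Set.indicator_of_mem hz _,
    fun _ hz => Set.indicator_of_notMem hz _⟩

lemma hardyENorm_indicator_one_le : hardyENorm (disc.indicator fun _ => (1 : ℂ)) ≤ 1 := by
  refine iSup_le fun r => ?_
  have hr : (r : ℝ) ∈ Set.Ico (0 : ℝ) 1 := ⟨r.2.1.le, r.2.2⟩
  rw [← ENNReal.pow_le_pow_left_iff two_ne_zero, circleNorm_sq indicator_one_mem_holo.1 hr,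
    circleMean]
  have : ∀ θ : ℝ, disc.indicator (fun _ => (1 : ℂ)) (circleMap 0 r θ) = 1 := fun θ =>
    Set.indicator_of_mem (circleMap_mem_disc' hr θ) _
  simp only [this]
  rw [intervalIntegral.integral_const, norm_one, one_pow, smul_eq_mul, mul_one, sub_zero,
    inv_mul_cancel₀ (by positivity)]
  simp

lemma norm_le_of_enorm_le {N N' : ℝ≥0∞} {M : ℝ} (hM : 0 ≤ M) (hN' : N' < ∞)
    (h : N ≤ ENNReal.ofReal M * N') : N.toReal ≤ M * N'.toReal := by
  have := ENNReal.toReal_mono (ENNReal.mul_ne_top ENNReal.ofReal_ne_top hN'.ne) h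
  rwa [ENNReal.toReal_mul, ENNReal.toReal_ofReal hM] at this

/-- The Hardy space as a space of holomorphic functions on the disc. -/
def hardyDiscSpace : DiscSpace HardySpace (1 / 2) where
  ev := hardySubmodule.subtype
  ev_injective := Subtype.val_injective
  ev_mem f := f.2.1
  pos := by norm_num
  exists_comp φ ψ M hφ hψ hM h f := by
    have hle := hardyENorm_weightedComp_le hφ hψ f.2 hM h
    refine ⟨⟨weightedComp φ ψ f, weightedComp_mem_holo hφ hψ f.2.1,
      hle.trans_lt (ENNReal.mul_lt_top ENNReal.ofReal_lt_top f.2.2)⟩,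
      fun z hz => weightedComp_apply hz, norm_le_of_enorm_le hM f.2.2 hle⟩
  exists_one := ⟨⟨_, indicator_one_mem_holo,
    hardyENorm_indicator_one_le.trans_lt ENNReal.one_lt_top⟩, fun z hz =>
    Set.indicator_of_mem hz fun _ => (1 : ℂ)⟩
  exists_norm_zero_le := by
    refine ⟨1, fun f => ?_⟩
    have h1 := (enorm_zero_le_bergmanENorm f.2.1 (α := 0) (by norm_num)).trans
      (bergmanENorm_le_hardyENorm f.2.1 (by norm_num))
    rw [one_mul]
    have := ENNReal.toReal_mono f.2.2.ne h1
    rwa [toReal_enorm] at this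

/-- The weighted Bergman space as a space of holomorphic functions on the disc. -/
def bergmanDiscSpace {α : ℝ} (hα : -1 < α) : DiscSpace (BergmanSpace α hα) ((α + 2) / 2) where
  ev := (bergmanSubmodule α).subtype
  ev_injective := Subtype.val_injective
  ev_mem f := f.2.1
  pos := by linarith
  exists_comp φ ψ M hφ hψ hM h f := by
    have hle := bergmanENorm_weightedComp_le hφ hψ f.2.1 hα hM h
    refine ⟨⟨weightedComp φ ψ f, weightedComp_mem_holo hφ hψ f.2.1,
      hle.trans_lt (ENNReal.mul_lt_top ENNReal.ofReal_lt_top f.2.2)⟩,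
      fun z hz => weightedComp_apply hz, norm_le_of_enorm_le hM f.2.2 hle⟩
  exists_one := ⟨⟨_, indicator_one_mem_holo,
    ((bergmanENorm_le_hardyENorm indicator_one_mem_holo hα).trans
      hardyENorm_indicator_one_le).trans_lt ENNReal.one_lt_top⟩,
    fun z hz =>
    Set.indicator_of_mem hz fun _ => (1 : ℂ)⟩
  exists_norm_zero_le := by
    refine ⟨1, fun f => ?_⟩
    have h1 := enorm_zero_le_bergmanENorm f.2.1 hα
    rw [one_mul]
    have := ENNReal.toReal_mono f.2.2.ne h1
    rwa [toReal_enorm] at this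

instance : CompleteSpace HardySpace := by
  refine hardyDiscSpace.completeSpace fun v F R hF hlim hR => ?_
  have hle : hardyENorm F ≤ ENNReal.ofReal R :=
    hardyENorm_le_of_tendsto (fun n => (v n).2.1) hlim fun n =>
      (ENNReal.le_ofReal_iff_toReal_le (v n).2.2.ne ((norm_nonneg _).trans (hR n))).2 (hR n)
  exact ⟨⟨F, hF, hle.trans_lt ENNReal.ofReal_lt_top⟩, rfl,
    ENNReal.toReal_le_of_le_ofReal ((norm_nonneg _).trans (hR 0)) hle⟩

instance {α : ℝ} {hα : -1 < α} : CompleteSpace (BergmanSpace α hα) := by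
  refine (bergmanDiscSpace hα).completeSpace fun v F R hF hlim hR => ?_
  have hle : bergmanENorm α F ≤ ENNReal.ofReal R :=
    bergmanENorm_le_of_tendsto (fun n => (v n).2.1) hlim fun n =>
      (ENNReal.le_ofReal_iff_toReal_le (v n).2.2.ne ((norm_nonneg _).trans (hR n))).2 (hR n)
  exact ⟨⟨F, hF, hle.trans_lt ENNReal.ofReal_lt_top⟩, rfl,
    ENNReal.toReal_le_of_le_ofReal ((norm_nonneg _).trans (hR 0)) hle⟩

lemma isWeight_of_diffContOnCl {ψ : ℂ → ℂ} {a b : ℂ} (ha : ‖a‖ = 1) (hb : ‖b‖ = 1)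
    (hψ : DiffContOnCl ℂ ψ disc) (hψ0 : BoundedAwayFromZero ψ) :
    IsWeight ψ a b ‖ψ a‖ ‖ψ b‖ := by
  have hcl : closure disc = closedBall (0 : ℂ) 1 := closure_ball _ one_ne_zero
  have hcont : ContinuousOn ψ (closedBall 0 1) := hcl ▸ hψ.2
  have hlim : ∀ x : ℂ, ‖x‖ = 1 → Tendsto (fun z => ‖ψ z‖) (𝓝[disc] x) (𝓝 ‖ψ x‖) := fun x hx =>
    ((hcont x (by simp [hx])).tendsto.mono_left (nhdsWithin_mono x ball_subset_closedBall)).norm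
  refine ⟨hψ.1, hψ0, ?_, hlim a ha, hlim b hb⟩
  obtain ⟨C, hC⟩ := (isCompact_closedBall (0 : ℂ) 1).exists_bound_of_continuousOn hcont
  exact ⟨C, fun z hz => hC z (ball_subset_closedBall hz)⟩

lemma analyticAt_mob {p z : ℂ} (u : ℂ) (hp : ‖p‖ < 1) (hz : ‖z‖ ≤ 1) : AnalyticAt ℂ (mob u p) z := by
  unfold mob
  exact AnalyticAt.div (by fun_prop) (by fun_prop) (mob_den_ne hp hz)

end WeightedComp

end

/-! ### The theorem for both kinds of spaces -/

open WeightedComp in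
theorem corollary3p12 (φ ψ : ℂ → ℂ) (a b : ℂ)
    (hφ : IsHyperbolicAut φ) (ha : IsDenjoyWolffPt φ a)
    (hb : IsBoundaryFixedPt φ b) (hba : b ≠ a)
    (hψ : DiffContOnCl ℂ ψ disc) (hψ0 : BoundedAwayFromZero ψ) :
    ∃ ρ : ℝ, 1 < ρ ∧ HasBoundaryDeriv φ (ρ : ℂ) b ∧ HasBoundaryDeriv φ ((ρ : ℂ)⁻¹) a ∧
      (∃ T : HardySpace →L[ℂ] HardySpace,
        (∀ f : HardySpace, ∀ z ∈ disc, T f z = ψ z * f (φ z)) ∧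
        spectrum ℂ T = annulus (‖ψ a‖ * ρ ^ (1 / 2 : ℝ)) (‖ψ b‖ * ρ ^ (-(1 / 2) : ℝ))) ∧
      ∀ (α : ℝ) (hα : -1 < α),
        ∃ T : BergmanSpace α hα →L[ℂ] BergmanSpace α hα,
          (∀ f : BergmanSpace α hα, ∀ z ∈ disc, T f z = ψ z * f (φ z)) ∧
          spectrum ℂ T =
            annulus (‖ψ a‖ * ρ ^ ((α + 2) / 2)) (‖ψ b‖ * ρ ^ (-((α + 2) / 2))) := by
  obtain ⟨u, p, ρ, H, hφm⟩ := exists_isHypMob hφ.1 ha hb hba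
  have W := isWeight_of_diffContOnCl H.norm_a H.norm_b hψ hψ0
  have hev : ∀ x : ℂ, ∀ᶠ z in 𝓝[disc] x, mob u p z = φ z := fun x => by
    filter_upwards [self_mem_nhdsWithin] with z hz using (hφm z hz).symm
  refine ⟨ρ, H.one_lt,
    ⟨mob u p, analyticAt_mob u H.norm_p H.norm_b.le, hev b, H.hasDerivAt_right⟩,
    ⟨mob u p, analyticAt_mob u H.norm_p H.norm_a.le, hev a, H.hasDerivAt_left⟩, ?_, fun α hα => ?_⟩
  · obtain ⟨T, hT, hσ⟩ := exists_spectrum_eq_annulus hardyDiscSpace H W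
    refine ⟨T, fun f z hz => ?_, hσ⟩
    rw [hφm z hz]
    exact hT f z hz
  · obtain ⟨T, hT, hσ⟩ := exists_spectrum_eq_annulus (bergmanDiscSpace hα) H W
    refine ⟨T, fun f z hz => ?_, hσ⟩
    rw [hφm z hz]
    exact hT f z hz
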